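/- For real random variables $X,Y$ on a common probability space with continuous distribution functions $F,G$, let $$\tau(X,Y)=\mathbb P\big((X_1-X_2)(Y_1-Y_2)>0\big)-\mathbb P\big((X_1-X_2)(Y_1-Y_2)<0\big),\qquad \rho(X,Y)=12\Big(\mathbb E\big[F(X)G(Y)\big]-\tfrac14\Big)$$ denote Kendall's tau and Spearman's rho, where $(X_1,Y_1),(X_2,Y_2)$ are independent copies of $(X,Y)$. Let $$\Omega=\{(\tau(X,Y),\rho(X,Y)): X,Y \text{ random variables with continuous distribution functions}\}$$ be the exact $\tau$-$\rho$ region. For integers $n\ge 2$ put $$\Phi_n(x)=-1-\frac4{n^2}+\frac3n+\frac{3x}n-\frac{n-2}{\sqrt2\,n^2\sqrt{n-1}}\,(n-2+nx)^{3/2},$$ let $\Phi:[-1,1]\to[-1,1]$ be the (well-defined) function with $\Phi(-1)=-1$ and $\Phi(x)=\Phi_n(x)$ for $x\in\big[\frac{2-n}{n},\frac{2-(n-1)}{n-1}\big]$, $n\ge2$, and let $$\Omega_\Phi=\{(x,y)\in[-1,1]^2:\ \Phi(x)\le y\le-\Phi(-x)\}.$$ Then $\Omega=\Omega_\Phi$.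 The same set is obtained from copulas: $\Omega=\{(\tau(A),\rho(A)): A \text{ a two-dimensional copula}\}$, where $\tau(A)=4\int_{[0,1]^2}A\,d\mu_A-1$, $\rho(A)=12\int_{[0,1]^2}xy\,d\mu_A(x,y)-3$, and $\mu_A$ is the measure on $[0,1]^2$ with $\mu_A([0,x]\times[0,y])=A(x,y)$. Moreover $\Omega$ is not convex, but it is compact and simply connected. Every $(x,y)\in\Omega$ satisfies the Durbin–Stuart inequalities $$\frac{(1+x)^2}{2}-1\le y\le 1-\frac{(1-x)^2}{2}.$$ With $p_n=\big(-1+\frac2n,-1+\frac2{n^2}\big)$ for $n\ge1$ (so $p_1=(1,1)$), the points of $\Omega$ at which the first inequality is an equality are exactly the points $p_n$, $n\ge1$, and their limit $(-1,-1)=-p_1$; the points of $\Omega$ at which the second is an equality are exactly the points $-p_n$, $n\ge1$, and $(1,1)=p_1$. -/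

import Mathlib

open MeasureTheory ProbabilityTheory

/-- Kendall's tau of `(X, Y)`: probability of concordance minus probability of discordance of two
independent copies, realised on the product probability space. -/
noncomputable def kendallTau {S : Type} [MeasurableSpace S] (P : Measure S) (X Y : S → ℝ) : ℝ :=
  (P.prod P).real {w | 0 < (X w.1 - X w.2) * (Y w.1 - Y w.2)} -
    (P.prod P).real {w | (X w.1 - X w.2) * (Y w.1 - Y w.2) < 0}

/-- Spearman's rho of `(X, Y)`: `12 (E[U V] - 1/4)` with `U = F ∘ X`, `V = G ∘ Y`, where `F`, `G`
are the distribution functions of `X`, `Y`. -/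
noncomputable def spearmanRho {S : Type} [MeasurableSpace S] (P : Measure S) (X Y : S → ℝ) : ℝ :=
  12 * ((∫ s, cdf (P.map X) (X s) * cdf (P.map Y) (Y s) ∂P) - 1 / 4)

/-- The exact tau-rho region: all pairs `(τ(X, Y), ρ(X, Y))` for random variables `X`, `Y` with
continuous distribution functions on a common probability space. -/
def exactRegion : Set (ℝ × ℝ) :=
  {p | ∃ (S : Type) (_ : MeasurableSpace S) (P : Measure S) (X Y : S → ℝ),
    IsProbabilityMeasure P ∧ Measurable X ∧ Measurable Y ∧
    Continuous (cdf (P.map X)) ∧ Continuous (cdf (P.map Y)) ∧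
    p = (kendallTau P X Y, spearmanRho P X Y)}

/-- Two-dimensional copulas: grounded, with uniform margins, and 2-increasing. -/
structure IsCopula (A : unitInterval → unitInterval → ℝ) : Prop where
  left_zero : ∀ y, A 0 y = 0
  right_zero : ∀ x, A x 0 = 0
  left_one : ∀ y, A 1 y = y
  right_one : ∀ x, A x 1 = x
  two_increasing : ∀ x₁ x₂ y₁ y₂, x₁ ≤ x₂ → y₁ ≤ y₂ →
    0 ≤ A x₂ y₂ - A x₁ y₂ - A x₂ y₁ + A x₁ y₁

/-- `μ` is the doubly stochastic measure of `A`, i.e. `μ ([0,x] × [0,y]) = A(x,y)`. -/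
def IsMeasureOf (A : unitInterval → unitInterval → ℝ)
    (μ : Measure (unitInterval × unitInterval)) : Prop :=
  ∀ x y, μ (Set.Icc 0 x ×ˢ Set.Icc 0 y) = ENNReal.ofReal (A x y)

/-- The pairs `(τ(A), ρ(A))`, `A` a copula with doubly stochastic measure `μ`, where
`τ(A) = 4 ∫ A dμ - 1` and `ρ(A) = 12 ∫ x y dμ(x,y) - 3`. -/
noncomputable def copulaRegion : Set (ℝ × ℝ) :=
  {p | ∃ (A : unitInterval → unitInterval → ℝ) (μ : Measure (unitInterval × unitInterval)),
    IsCopula A ∧ IsMeasureOf A μ ∧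
    p = (4 * (∫ z, A z.1 z.2 ∂μ) - 1, 12 * (∫ z, (z.1 : ℝ) * (z.2 : ℝ) ∂μ) - 3)}

/-- The function `Φ_n`. -/
noncomputable def PhiN (n : ℕ) (x : ℝ) : ℝ :=
  -1 - 4 / (n : ℝ) ^ 2 + 3 / n + 3 * x / n -
    ((n : ℝ) - 2) / (√2 * (n : ℝ) ^ 2 * √((n : ℝ) - 1)) * ((n : ℝ) - 2 + n * x) ^ (3 / 2 : ℝ)

/-- The interval `[(2-n)/n, (2-(n-1))/(n-1)]` on which `Φ` is given by `Φ_n` (for `n ≥ 2`). -/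
noncomputable def phiInterval (n : ℕ) : Set ℝ :=
  Set.Icc ((2 - (n : ℝ)) / n) ((2 - ((n : ℝ) - 1)) / ((n : ℝ) - 1))

open Classical in
/-- The function `Φ` on `[-1, 1]`: `Φ = Φ_n` on the `n`-th interval, and `Φ(-1) = -1`. The value
does not depend on the chosen `n`, see `Phi_eq_PhiN`. -/
noncomputable def Phi (x : ℝ) : ℝ :=
  if h : ∃ n : ℕ, 2 ≤ n ∧ x ∈ phiInterval n then PhiN h.choose x else -1

/-- The region `Ω_Φ`. -/
def regionPhi : Set (ℝ × ℝ) :=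
  {p | p.1 ∈ Set.Icc (-1 : ℝ) 1 ∧ p.2 ∈ Set.Icc (-1 : ℝ) 1 ∧
    Phi p.1 ≤ p.2 ∧ p.2 ≤ -Phi (-p.1)}

/-- The points `p_n = (-1 + 2/n, -1 + 2/n²)`. -/
noncomputable def dsPoint (n : ℕ) : ℝ × ℝ :=
  (-1 + 2 / (n : ℝ), -1 + 2 / (n : ℝ) ^ 2)

theorem PhiN_overlap {n : ℕ} (hn : 2 ≤ n) :
    PhiN (n + 1) ((2 - (n : ℝ)) / n) = PhiN n ((2 - (n : ℝ)) / n) := by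
  have h0 : (2 : ℝ) ≤ n := by exact_mod_cast hn
  have hpos : (0 : ℝ) < n := by linarith
  have e1 : ((n : ℝ) - 2 + n * ((2 - (n : ℝ)) / n)) = 0 := by field_simp; ring
  have e2 : ((n + 1 : ℝ) - 2 + (n + 1) * ((2 - (n : ℝ)) / n)) = 2 / n := by field_simp; ring
  have e3 : (2 / (n : ℝ)) ^ (3 / 2 : ℝ) = (2 / n) * (√2 / √n) := by
    rw [show (3 / 2 : ℝ) = 1 + 1 / 2 by norm_num, Real.rpow_add (by positivity), Real.rpow_one,
      ← Real.sqrt_eq_rpow, Real.sqrt_div (by norm_num)]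
  have e4 : (√(n : ℝ)) ^ 2 = n := Real.sq_sqrt hpos.le
  have e5 : 0 < √(n : ℝ) := Real.sqrt_pos.2 hpos
  have e6 : 0 < √(2 : ℝ) := Real.sqrt_pos.2 (by norm_num)
  unfold PhiN
  push_cast
  rw [e1, e2, e3, Real.zero_rpow (by norm_num), add_sub_cancel_right]
  have : ((n : ℝ) + 1 - 2) / (√2 * ((n : ℝ) + 1) ^ 2 * √n) * (2 / n * (√2 / √n)) =
      2 * ((n : ℝ) - 1) / (((n : ℝ) + 1) ^ 2 * n * n) := by
    field_simp
    rw [e4]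
    ring
  rw [this]
  field_simp
  ring

/-- `Φ` is well defined by its case distinction. -/
theorem Phi_eq_PhiN {n : ℕ} {x : ℝ} (hn : 2 ≤ n) (hx : x ∈ phiInterval n) :
    Phi x = PhiN n x := by
  have key : ∀ m k : ℕ, 2 ≤ m → m < k → x ∈ phiInterval m → x ∈ phiInterval k →
      PhiN m x = PhiN k x := by
    intro m k hm hmk h1 h2
    have hm' : (2 : ℝ) ≤ m := by exact_mod_cast hm
    have hmk' : (m : ℝ) + 1 ≤ k := by exact_mod_cast hmk
    have a1 := h1.1
    have a2 := h2.2
    rw [div_le_iff₀ (by linarith)] at a1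
    rw [le_div_iff₀ (by linarith)] at a2
    have hx1 : 0 < x + 1 := by nlinarith
    have hk : (k : ℝ) = m + 1 := by nlinarith
    have hk2 : k = m + 1 := by exact_mod_cast hk
    subst hk2
    have hxe : x = (2 - (m : ℝ)) / m := by
      rw [eq_div_iff (by linarith)]
      push_cast at a2
      linarith
    rw [hxe]
    exact (PhiN_overlap hm).symm
  have h : ∃ n : ℕ, 2 ≤ n ∧ x ∈ phiInterval n := ⟨n, hn, hx⟩
  rw [Phi, dif_pos h]
  obtain ⟨c1, c2⟩ := h.choose_spec
  rcases lt_trichotomy h.choose n with hl | he | hg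
  · exact key _ _ c1 hl c2 hx
  · rw [he]
  · exact (key _ _ hn hg hx c2).symm

/-- The value of `Φ` at the left end point. -/
theorem Phi_neg_one : Phi (-1) = -1 := by
  rw [Phi, dif_neg]
  rintro ⟨n, hn, hx⟩
  have h0 : (2 : ℝ) ≤ n := by exact_mod_cast hn
  have h1 := hx.1
  rw [div_le_iff₀ (by linarith)] at h1
  linarith

/-!
Join two points of the support of a doubly stochastic measure when they are concordant. The edge
density of this graph is `d = (1 + τ) / 2`. A random triple of points has a concordance graph
spanning at least two edges with probability `F = (1 + ρ) / 2`: the product of the three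
concordance signs in the two coordinates expands into rank correlations because the three cyclic
differences of a coordinate sum to zero. So the lower bound for `ρ` is an inequality `B(d) ≤ F`
for all weighted graphs, where `B` is `Φ` in the coordinates `d`, `F` (`cliqueBound`); the
extremal graphs are disjoint unions of cliques of equal size and one smaller clique.

For a minimiser of `F - B(d)` on a fixed finite vertex set, the first order conditions in the
vertex and edge weights show that replacing the neighbourhood of any vertex by an isolated clique
does not increase the Lagrangian, which is `F` minus a multiple of `d`. For a suitable vertex,
rescaling what is left to total mass one then yields a better graph, unless `B(d) ≤ F` already
holds. General measures are limits of finitely supported ones.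

Conversely, disjoint unions of cliques are skew sums of diagonal measures. Deforming them by
moving mass between cliques, together with the reflection `(τ, ρ) ↦ (-τ, -ρ)`, realises every
point of the region by the intermediate value theorem.
-/

/-! ### The bound in terms of clique sizes -/

/-- A partition of a set of mass one into `k` cliques of mass `a` and one clique of mass `b ≤ a`.
Such a graph has edge density `k * a ^ 2 + b ^ 2`, and a random triple of its vertices spans at
least two edges with probability `k * a ^ 3 + b ^ 3`. -/
structure IsCliqueProfile (k : ℕ) (a b : ℝ) : Prop where
  one_le : 1 ≤ k
  nonneg : 0 ≤ b
  le : b ≤ a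
  mass : k * a + b = 1

/-- The function `Φ` in the coordinates `d = (1 + τ) / 2` and `F = (1 + ρ) / 2`. -/
noncomputable def cliqueBound (d : ℝ) : ℝ := (Phi (2 * d - 1) + 1) / 2

/-- The closed form of `cliqueBound` on `[1 / (k + 1), 1 / k]`. -/
noncomputable def cliquePiece (k : ℕ) (d : ℝ) : ℝ :=
  3 * d / (k + 1) - 2 / ((k : ℝ) + 1) ^ 2 -
    ((k : ℝ) - 1) / (((k : ℝ) + 1) ^ 2 * √k) * √((k + 1) * d - 1) ^ 3

theorem cliqueBound_half (x : ℝ) : cliqueBound ((1 + x) / 2) = (Phi x + 1) / 2 := by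
  rw [cliqueBound]
  ring_nf

theorem cliqueBound_zero : cliqueBound 0 = 0 := by simp [cliqueBound, Phi_neg_one]

theorem cliqueBound_eq_cliquePiece {k : ℕ} (hk : 1 ≤ k) {d : ℝ} (h₁ : 1 ≤ (k + 1) * d)
    (h₂ : k * d ≤ 1) : cliqueBound d = cliquePiece k d := by
  have hk' : (0 : ℝ) < k := by exact_mod_cast hk
  have hmem : 2 * d - 1 ∈ phiInterval (k + 1) := by
    constructor
    · rw [div_le_iff₀ (by positivity)]
      push_cast
      linarith
    · push_cast
      rw [add_sub_cancel_right, le_div_iff₀ hk']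
      linarith
  have hpow : (2 * ((k + 1) * d - 1)) ^ (3 / 2 : ℝ) = 2 * √2 * √((k + 1) * d - 1) ^ 3 := by
    have hnn : 0 ≤ (k + 1) * d - 1 := by linarith
    rw [show (3 / 2 : ℝ) = 1 + 1 / 2 by norm_num, Real.rpow_add_of_nonneg (by positivity)
      (by norm_num) (by norm_num), Real.rpow_one, ← Real.sqrt_eq_rpow, Real.sqrt_mul two_pos.le,
      pow_succ _ 2, Real.sq_sqrt hnn]
    ring
  rw [cliqueBound, Phi_eq_PhiN (by omega) hmem, PhiN, cliquePiece]
  push_cast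
  rw [show (k : ℝ) + 1 - 2 + (k + 1) * (2 * d - 1) = 2 * ((k + 1) * d - 1) by ring, hpow,
    add_sub_cancel_right]
  have : √(k : ℝ) ≠ 0 := (Real.sqrt_pos.2 hk').ne'
  field_simp
  ring

theorem continuous_cliquePiece (k : ℕ) : Continuous (cliquePiece k) := by
  unfold cliquePiece
  fun_prop

theorem hasDerivAt_cliquePiece {k : ℕ} {d : ℝ} (hd : 1 < (k + 1) * d) :
    HasDerivAt (cliquePiece k)
      (3 / (k + 1) - 3 / 2 * (((k : ℝ) - 1) / ((k + 1) * √k)) * √((k + 1) * d - 1)) d := by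
  have hpos : 0 < (k + 1) * d - 1 := by linarith
  have hlin : HasDerivAt (fun t : ℝ => ((k : ℝ) + 1) * t - 1) (k + 1) d := by
    simpa using ((hasDerivAt_id d).const_mul ((k : ℝ) + 1)).sub_const 1
  have hcube := ((hlin.sqrt hpos.ne').pow 3).const_mul
    (((k : ℝ) - 1) / (((k : ℝ) + 1) ^ 2 * √k))
  have haff := (((hasDerivAt_id d).const_mul (3 : ℝ)).div_const ((k : ℝ) + 1)).sub_const
    (2 / ((k : ℝ) + 1) ^ 2)
  refine (haff.sub hcube).congr_deriv ?_
  have hsqrt : √((k + 1) * d - 1) ≠ 0 := (Real.sqrt_pos.2 hpos).ne'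
  have hk : (k : ℝ) + 1 ≠ 0 := by positivity
  rw [mul_one, sub_right_inj]
  push_cast
  field_simp

namespace IsCliqueProfile

variable {k : ℕ} {a b : ℝ}

theorem one_le_cast (h : IsCliqueProfile k a b) : (1 : ℝ) ≤ k := by exact_mod_cast h.one_le

theorem pos (h : IsCliqueProfile k a b) : 0 < a := by
  refine (h.nonneg.trans h.le).lt_of_ne fun ha => ?_
  have hb : b ≤ 0 := ha ▸ h.le
  have := h.mass
  rw [← ha, mul_zero] at this
  linarith

theorem le_one (h : IsCliqueProfile k a b) : a ≤ 1 := by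
  nlinarith [h.mass, h.nonneg, h.pos, h.one_le_cast]

theorem succ_mul_density_sub_one (h : IsCliqueProfile k a b) :
    (k + 1) * (k * a ^ 2 + b ^ 2) - 1 = k * (a - b) ^ 2 := by
  linear_combination (k * a + b + 1) * h.mass

theorem one_sub_mul_density (h : IsCliqueProfile k a b) :
    1 - k * (k * a ^ 2 + b ^ 2) = k * (b * (2 * a - b)) + b ^ 2 := by
  linear_combination (-(k * a + b) - 1) * h.mass

theorem one_le_succ_mul_density (h : IsCliqueProfile k a b) :
    1 ≤ (k + 1) * (k * a ^ 2 + b ^ 2) := by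
  have : 0 ≤ k * (a - b) ^ 2 := by positivity
  linarith [h.succ_mul_density_sub_one]

theorem mul_density_le_one (h : IsCliqueProfile k a b) : k * (k * a ^ 2 + b ^ 2) ≤ 1 := by
  have hab : 0 ≤ 2 * a - b := by linarith [h.le, h.nonneg]
  have : 0 ≤ k * (b * (2 * a - b)) := mul_nonneg k.cast_nonneg (mul_nonneg h.nonneg hab)
  linarith [h.one_sub_mul_density, sq_nonneg b]

theorem sqrt_succ_mul_density_sub_one (h : IsCliqueProfile k a b) :
    √((k + 1) * (k * a ^ 2 + b ^ 2) - 1) = √k * (a - b) := by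
  rw [h.succ_mul_density_sub_one, Real.sqrt_mul k.cast_nonneg, Real.sqrt_sq (sub_nonneg.2 h.le)]

theorem cliqueBound_density (h : IsCliqueProfile k a b) :
    cliqueBound (k * a ^ 2 + b ^ 2) = k * a ^ 3 + b ^ 3 := by
  rw [cliqueBound_eq_cliquePiece h.one_le h.one_le_succ_mul_density h.mul_density_le_one,
    cliquePiece, h.sqrt_succ_mul_density_sub_one]
  have hk : (0 : ℝ) < k := zero_lt_one.trans_le h.one_le_cast
  have hsqrt : √(k : ℝ) ≠ 0 := (Real.sqrt_pos.2 hk).ne'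
  have hcube : (√(k : ℝ) * (a - b)) ^ 3 = √k * (k * (a - b) ^ 3) := by
    linear_combination √(k : ℝ) * (a - b) ^ 3 * Real.sq_sqrt hk.le
  obtain rfl : b = 1 - k * a := by linarith [h.mass]
  rw [hcube]
  field_simp
  ring

theorem triple_sub_sq_density (h : IsCliqueProfile k a b) :
    k * a ^ 3 + b ^ 3 - (k * a ^ 2 + b ^ 2) ^ 2 = k * a * b * (a - b) ^ 2 := by
  linear_combination (-(k * a ^ 3 + b ^ 3)) * h.mass

theorem triple_eq (h : IsCliqueProfile k a b) :
    k * a ^ 3 + b ^ 3 = (a + b) * (k * a ^ 2 + b ^ 2) - a * b := by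
  linear_combination (-(a * b)) * h.mass

theorem hasDerivAt_cliqueBound (h : IsCliqueProfile k a b) (hb : 0 < b) (hba : b < a) :
    HasDerivAt cliqueBound (3 / 2 * (a + b)) (k * a ^ 2 + b ^ 2) := by
  have hk : (0 : ℝ) < k := zero_lt_one.trans_le h.one_le_cast
  have h₁ : 1 < (k + 1) * (k * a ^ 2 + b ^ 2) := by
    have : 0 < k * (a - b) ^ 2 := mul_pos hk (pow_pos (sub_pos.2 hba) 2)
    linarith [h.succ_mul_density_sub_one]
  have h₂ : k * (k * a ^ 2 + b ^ 2) < 1 := by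
    have : 0 < k * (b * (2 * a - b)) := mul_pos hk (mul_pos hb (by linarith))
    linarith [h.one_sub_mul_density, sq_nonneg b]
  have heq : cliqueBound =ᶠ[nhds (k * a ^ 2 + b ^ 2)] cliquePiece k := by
    filter_upwards [(continuous_const_mul ((k : ℝ) + 1)).tendsto _ |>.eventually (lt_mem_nhds h₁),
      (continuous_const_mul (k : ℝ)).tendsto _ |>.eventually (gt_mem_nhds h₂)] with t ht₁ ht₂
    exact cliqueBound_eq_cliquePiece h.one_le ht₁.le ht₂.le
  refine ((hasDerivAt_cliquePiece h₁).congr_of_eventuallyEq heq).congr_deriv ?_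
  have hsqrt : √(k : ℝ) ≠ 0 := (Real.sqrt_pos.2 hk).ne'
  rw [h.sqrt_succ_mul_density_sub_one]
  field_simp
  linear_combination (-2 : ℝ) * h.mass

end IsCliqueProfile

theorem exists_isCliqueProfile_of_mem_piece {k : ℕ} (hk : 1 ≤ k) {d : ℝ} (h₁ : 1 ≤ (k + 1) * d)
    (h₂ : k * d ≤ 1) : ∃ a b, IsCliqueProfile k a b ∧ k * a ^ 2 + b ^ 2 = d := by
  have hk' : (1 : ℝ) ≤ k := by exact_mod_cast hk
  -- `r` is the difference `a - b`, see `IsCliqueProfile.succ_mul_density_sub_one`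
  obtain ⟨r, hr, hr2⟩ : ∃ r : ℝ, 0 ≤ r ∧ k * r ^ 2 = (k + 1) * d - 1 := by
    refine ⟨√(((k + 1) * d - 1) / k), Real.sqrt_nonneg _, ?_⟩
    rw [Real.sq_sqrt (div_nonneg (by linarith) (by linarith))]
    field_simp
  have hkr : k * r ≤ 1 := by
    refine le_of_sq_le_sq (b := 1) ?_ zero_le_one
    calc (k * r) ^ 2 = (k + 1) * (k * d) - k := by linear_combination (k : ℝ) * hr2
      _ ≤ (k + 1) * 1 - k := by gcongr
      _ = 1 ^ 2 := by ring
  refine ⟨(1 + r) / (k + 1), (1 - k * r) / (k + 1), ⟨hk, by bound, ?_, ?_⟩, ?_⟩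
  · gcongr
    nlinarith
  · field_simp
    ring
  · field_simp
    linear_combination ((k : ℝ) + 1) * hr2

theorem exists_nat_piece {d : ℝ} (hd : 0 < d) (hd1 : d ≤ 1) :
    ∃ k : ℕ, 1 ≤ k ∧ 1 ≤ (k + 1) * d ∧ k * d ≤ 1 := by
  refine ⟨⌊1 / d⌋₊, ?_, ?_, ?_⟩
  · rwa [Nat.one_le_floor_iff, one_le_div hd]
  · exact ((div_lt_iff₀ hd).1 (Nat.lt_floor_add_one (1 / d))).le
  · exact (le_div_iff₀ hd).1 (Nat.floor_le (by positivity))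

theorem exists_isCliqueProfile {d : ℝ} (hd : 0 < d) (hd1 : d ≤ 1) :
    ∃ (k : ℕ) (a b : ℝ), IsCliqueProfile k a b ∧ k * a ^ 2 + b ^ 2 = d := by
  obtain ⟨k, hk, h₁, h₂⟩ := exists_nat_piece hd hd1
  exact ⟨k, exists_isCliqueProfile_of_mem_piece hk h₁ h₂⟩

theorem sq_le_cliqueBound {d : ℝ} (hd : 0 ≤ d) (hd1 : d ≤ 1) : d ^ 2 ≤ cliqueBound d := by
  rcases hd.eq_or_lt with rfl | hd
  · simp [cliqueBound_zero]
  obtain ⟨k, a, b, h, rfl⟩ := exists_isCliqueProfile hd hd1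
  have : 0 ≤ k * a * b * (a - b) ^ 2 := by
    have := h.nonneg
    have := h.pos
    positivity
  rw [h.cliqueBound_density]
  linarith [h.triple_sub_sq_density]

theorem cliqueBound_le_self {d : ℝ} (hd : 0 ≤ d) (hd1 : d ≤ 1) : cliqueBound d ≤ d := by
  rcases hd.eq_or_lt with rfl | hd
  · exact cliqueBound_zero.le
  obtain ⟨k, a, b, h, rfl⟩ := exists_isCliqueProfile hd hd1
  rw [h.cliqueBound_density]
  have ha := pow_le_pow_of_le_one h.pos.le h.le_one (show 2 ≤ 3 by norm_num)
  have hb := pow_le_pow_of_le_one h.nonneg (h.le.trans h.le_one) (show 2 ≤ 3 by norm_num)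
  gcongr

theorem cliqueBound_eq_sq_iff {d : ℝ} (hd : 0 < d) (hd1 : d ≤ 1) :
    cliqueBound d = d ^ 2 ↔ ∃ k : ℕ, 1 ≤ k ∧ d = 1 / k := by
  constructor
  · intro heq
    obtain ⟨k, a, b, h, rfl⟩ := exists_isCliqueProfile hd hd1
    have hk : (0 : ℝ) < k := zero_lt_one.trans_le h.one_le_cast
    have hz : k * a * b * (a - b) ^ 2 = 0 := by
      rw [← h.triple_sub_sq_density, ← h.cliqueBound_density, heq, sub_self]
    have hcase : b = 0 ∨ a = b := by
      simpa [hk.ne', h.pos.ne', sub_eq_zero] using hz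
    rcases hcase with rfl | rfl
    · refine ⟨k, h.one_le, ?_⟩
      rw [eq_div_iff hk.ne']
      linear_combination (k * a + 1) * h.mass
    · refine ⟨k + 1, by omega, ?_⟩
      rw [eq_div_iff (by positivity)]
      push_cast
      linear_combination ((k + 1) * a + 1) * h.mass
  · rintro ⟨k, hk, rfl⟩
    have hk' : (k : ℝ) ≠ 0 := by positivity
    have h : IsCliqueProfile k (1 / k) 0 := ⟨hk, le_rfl, by positivity, by field_simp; ring⟩
    have hd : (1 / k : ℝ) = k * (1 / k) ^ 2 + 0 ^ 2 := by field_simp; ring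
    rw [hd, h.cliqueBound_density]
    field_simp
    ring

theorem cliqueBound_one : cliqueBound 1 = 1 := by
  simpa using (cliqueBound_eq_sq_iff one_pos le_rfl).2 ⟨1, le_rfl, by norm_num⟩

theorem continuousOn_cliqueBound_piece {k : ℕ} (hk : 1 ≤ k) :
    ContinuousOn cliqueBound (Set.Icc (1 / (k + 1)) (1 / k)) := by
  refine (continuous_cliquePiece k).continuousOn.congr fun d hd => ?_
  refine cliqueBound_eq_cliquePiece hk ?_ ?_
  · rw [mul_comm]
    exact (div_le_iff₀ (by positivity)).1 hd.1
  · rw [mul_comm]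
    exact (le_div_iff₀ (by positivity)).1 hd.2

theorem continuousOn_cliqueBound_Icc_one (m : ℕ) :
    ContinuousOn cliqueBound (Set.Icc (1 / ((m : ℝ) + 1)) 1) := by
  induction m with
  | zero => simp
  | succ m ih =>
    have hpiece := continuousOn_cliqueBound_piece (Nat.le_add_left 1 m)
    push_cast at hpiece ⊢
    rw [← Set.Icc_union_Icc_eq_Icc (b := 1 / ((m : ℝ) + 1)) (by gcongr; linarith)
      ((div_le_one (by positivity)).2 (by simp))]
    exact hpiece.union_of_isClosed ih isClosed_Icc isClosed_Icc

theorem continuousOn_cliqueBound : ContinuousOn cliqueBound (Set.Icc 0 1) := by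
  intro d hd
  rcases hd.1.eq_or_lt with rfl | hd0
  · rw [ContinuousWithinAt, cliqueBound_zero]
    refine tendsto_of_tendsto_of_tendsto_of_le_of_le' (g := fun _ => (0 : ℝ)) (h := id)
      tendsto_const_nhds (Filter.tendsto_id.mono_left nhdsWithin_le_nhds) ?_ ?_
    · filter_upwards [self_mem_nhdsWithin] with t ht
      exact (sq_nonneg t).trans (sq_le_cliqueBound ht.1 ht.2)
    · filter_upwards [self_mem_nhdsWithin] with t ht
      exact cliqueBound_le_self ht.1 ht.2
  · obtain ⟨m, hm⟩ := exists_nat_one_div_lt hd0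
    refine (continuousOn_cliqueBound_Icc_one m d ⟨hm.le, hd.2⟩).mono_of_mem_nhdsWithin ?_
    filter_upwards [self_mem_nhdsWithin, mem_nhdsWithin_of_mem_nhds (lt_mem_nhds hm)] with t ht ht0
    exact ⟨ht0.le, ht.2⟩

/-! ### Weighted sums over pairs and triples -/

/-- The probability that at least two of three independent events of probabilities `x`, `y`, `z`
occur. -/
def maj3 (x y z : ℝ) : ℝ := x * y + y * z + z * x - 2 * x * y * z

section WeightedSums

variable {V : Type*} [Fintype V] {w : V → ℝ}

/-- The sum of a kernel over pairs of vertices with weights `w`. -/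
def pairSum (w : V → ℝ) (g : V → V → ℝ) : ℝ := ∑ i, ∑ j, w i * w j * g i j

/-- The sum of a kernel over triples of vertices with weights `w`. -/
def tripleSum (w : V → ℝ) (φ : V → V → V → ℝ) : ℝ :=
  ∑ i, ∑ j, ∑ k, w i * w j * w k * φ i j k

/-- The sum of a ternary kernel over all orderings of its arguments; comparing two kernels under
`tripleSum` reduces to comparing these symmetrizations pointwise. -/
def permSum {V : Type*} (φ : V → V → V → ℝ) (i j k : V) : ℝ :=
  φ i j k + φ i k j + φ j i k + φ j k i + φ k i j + φ k j i

theorem pairSum_eq_sum (w : V → ℝ) (g : V → V → ℝ) :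
    pairSum w g = ∑ i, w i * ∑ j, w j * g i j := by
  simp only [pairSum, Finset.mul_sum, mul_assoc]

theorem pairSum_add (w : V → ℝ) (g g' : V → V → ℝ) :
    pairSum w (fun i j => g i j + g' i j) = pairSum w g + pairSum w g' := by
  simp only [pairSum, mul_add, Finset.sum_add_distrib]

theorem pairSum_sub (w : V → ℝ) (g g' : V → V → ℝ) :
    pairSum w (fun i j => g i j - g' i j) = pairSum w g - pairSum w g' := by
  simp only [pairSum, mul_sub, Finset.sum_sub_distrib]

theorem pairSum_const_mul (w : V → ℝ) (c : ℝ) (g : V → V → ℝ) :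
    pairSum w (fun i j => c * g i j) = c * pairSum w g := by
  simp only [pairSum, Finset.mul_sum, mul_left_comm]

theorem pairSum_mul (w f g : V → ℝ) :
    pairSum w (fun i j => f i * g j) = (∑ i, w i * f i) * ∑ j, w j * g j := by
  simp only [pairSum, Finset.sum_mul_sum]
  refine Finset.sum_congr rfl fun i _ => Finset.sum_congr rfl fun j _ => by ring

theorem pairSum_const (hw : ∑ i, w i = 1) (c : ℝ) : pairSum w (fun _ _ => c) = c := by
  simp only [pairSum, ← Finset.sum_mul, ← Finset.mul_sum, hw, one_mul]

theorem pairSum_swap (w : V → ℝ) (g : V → V → ℝ) :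
    pairSum w (fun i j => g j i) = pairSum w g := by
  simp only [pairSum]
  rw [Finset.sum_comm]
  simp only [mul_comm (w _) (w _)]

theorem pairSum_congr_of_add_swap {g g' : V → V → ℝ}
    (h : ∀ i j, g i j + g j i = g' i j + g' j i) : pairSum w g = pairSum w g' := by
  have hsum : pairSum w (fun i j => g i j + g j i) = pairSum w (fun i j => g' i j + g' j i) := by
    simp only [h]
  rw [pairSum_add, pairSum_add, pairSum_swap w g, pairSum_swap w g'] at hsum
  linarith

theorem pairSum_nonneg (hw : ∀ i, 0 ≤ w i) {g : V → V → ℝ} (hg : ∀ i j, 0 ≤ g i j) :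
    0 ≤ pairSum w g :=
  Finset.sum_nonneg fun i _ => Finset.sum_nonneg fun j _ =>
    mul_nonneg (mul_nonneg (hw i) (hw j)) (hg i j)

theorem pairSum_weight_mul (w f : V → ℝ) (g : V → V → ℝ) :
    pairSum (fun i => w i * f i) g = pairSum w (fun i j => f i * f j * g i j) := by
  refine Finset.sum_congr rfl fun i _ => Finset.sum_congr rfl fun j _ => by ring

theorem tripleSum_add (w : V → ℝ) (φ ψ : V → V → V → ℝ) :
    tripleSum w (fun i j k => φ i j k + ψ i j k) = tripleSum w φ + tripleSum w ψ := by
  simp only [tripleSum, mul_add, Finset.sum_add_distrib]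

theorem tripleSum_sub (w : V → ℝ) (φ ψ : V → V → V → ℝ) :
    tripleSum w (fun i j k => φ i j k - ψ i j k) = tripleSum w φ - tripleSum w ψ := by
  simp only [tripleSum, mul_sub, Finset.sum_sub_distrib]

theorem tripleSum_const_mul (w : V → ℝ) (c : ℝ) (φ : V → V → V → ℝ) :
    tripleSum w (fun i j k => c * φ i j k) = c * tripleSum w φ := by
  simp only [tripleSum, Finset.mul_sum, mul_left_comm]

theorem tripleSum_left_mul (w f : V → ℝ) (φ : V → V → V → ℝ) :
    tripleSum w (fun i j k => f i * φ i j k) = ∑ i, w i * f i * pairSum w (φ i) := by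
  simp only [tripleSum, pairSum, Finset.mul_sum]
  refine Finset.sum_congr rfl fun i _ => Finset.sum_congr rfl fun j _ =>
    Finset.sum_congr rfl fun k _ => by ring

theorem tripleSum_eq_sum_pairSum (w : V → ℝ) (φ : V → V → V → ℝ) :
    tripleSum w φ = ∑ i, w i * pairSum w (φ i) := by
  simpa using tripleSum_left_mul w (fun _ => 1) φ

theorem tripleSum_mul (w f : V → ℝ) (g : V → V → ℝ) :
    tripleSum w (fun i j k => f i * g j k) = (∑ i, w i * f i) * pairSum w g := by
  rw [tripleSum_left_mul w f fun _ => g, Finset.sum_mul]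

theorem tripleSum_weight_mul (w f : V → ℝ) (φ : V → V → V → ℝ) :
    tripleSum (fun i => w i * f i) φ = tripleSum w (fun i j k => f i * f j * f k * φ i j k) := by
  refine Finset.sum_congr rfl fun i _ => Finset.sum_congr rfl fun j _ =>
    Finset.sum_congr rfl fun k _ => by ring

theorem tripleSum_swap_left (w : V → ℝ) (φ : V → V → V → ℝ) :
    tripleSum w (fun i j k => φ j i k) = tripleSum w φ := by
  rw [tripleSum, Finset.sum_comm]
  refine Finset.sum_congr rfl fun i _ => Finset.sum_congr rfl fun j _ =>
    Finset.sum_congr rfl fun k _ => by ring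

theorem tripleSum_swap_right (w : V → ℝ) (φ : V → V → V → ℝ) :
    tripleSum w (fun i j k => φ i k j) = tripleSum w φ := by
  rw [tripleSum_eq_sum_pairSum, tripleSum_eq_sum_pairSum w φ]
  exact Finset.sum_congr rfl fun i _ => by rw [pairSum_swap w (φ i)]

theorem tripleSum_permSum (w : V → ℝ) (φ : V → V → V → ℝ) :
    tripleSum w (permSum φ) = 6 * tripleSum w φ := by
  have hrot : tripleSum w (fun i j k => φ j k i) = tripleSum w φ :=
    (tripleSum_swap_left w fun i j k => φ i k j).trans (tripleSum_swap_right w φ)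
  have hrot' : tripleSum w (fun i j k => φ k i j) = tripleSum w φ :=
    (tripleSum_swap_right w fun i j k => φ j i k).trans (tripleSum_swap_left w φ)
  have hflip : tripleSum w (fun i j k => φ k j i) = tripleSum w φ :=
    (tripleSum_swap_left w fun i j k => φ k i j).trans hrot'
  change tripleSum w (fun i j k => φ i j k + φ i k j + φ j i k + φ j k i + φ k i j + φ k j i) = _
  rw [tripleSum_add, tripleSum_add, tripleSum_add, tripleSum_add, tripleSum_add,
    tripleSum_swap_left w φ, tripleSum_swap_right w φ, hrot, hrot', hflip]
  ring

theorem tripleSum_nonneg (hw : ∀ i, 0 ≤ w i) {φ : V → V → V → ℝ}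
    (hφ : ∀ i j k, 0 ≤ φ i j k) : 0 ≤ tripleSum w φ := by
  rw [tripleSum_eq_sum_pairSum]
  exact Finset.sum_nonneg fun i _ => mul_nonneg (hw i) (pairSum_nonneg hw (hφ i))

theorem tripleSum_le_of_permSum_le (hw : ∀ i, 0 ≤ w i) {φ ψ : V → V → V → ℝ}
    (h : ∀ i j k, permSum φ i j k ≤ permSum ψ i j k) : tripleSum w φ ≤ tripleSum w ψ := by
  have hsum := tripleSum_nonneg hw fun i j k => sub_nonneg.2 (h i j k)
  rw [tripleSum_sub, tripleSum_permSum, tripleSum_permSum] at hsum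
  linarith

theorem tripleSum_congr_of_permSum {φ ψ : V → V → V → ℝ}
    (h : ∀ i j k, permSum φ i j k = permSum ψ i j k) : tripleSum w φ = tripleSum w ψ := by
  have hsum := congrArg (tripleSum w) (funext fun i => funext fun j => funext (h i j))
  rw [tripleSum_permSum, tripleSum_permSum] at hsum
  linarith

theorem hasDerivAt_add_mul_zero (x y : ℝ) : HasDerivAt (fun t : ℝ => x + t * y) y 0 := by
  simpa using ((hasDerivAt_id (0 : ℝ)).mul_const y).const_add x

theorem hasDerivAt_pairSum_weight {g : V → V → ℝ} (hg : ∀ i j, g i j = g j i) (p : V → ℝ) :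
    HasDerivAt (fun t : ℝ => pairSum (fun i => w i + t * p i) g)
      (2 * ∑ i, p i * ∑ j, w j * g i j) 0 := by
  have hl i := hasDerivAt_add_mul_zero (w i) (p i)
  refine (HasDerivAt.fun_sum fun i _ => HasDerivAt.fun_sum fun j _ =>
    ((hl i).mul (hl j)).mul_const (g i j)).congr_deriv ?_
  have hleft : ∑ i, p i * ∑ j, w j * g i j = ∑ i, ∑ j, p i * w j * g i j := by
    simp only [Finset.mul_sum, mul_assoc]
  have hright : ∑ i, ∑ j, w i * p j * g i j = ∑ i, ∑ j, p i * w j * g i j := by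
    rw [Finset.sum_comm]
    simp only [hg, mul_comm (w _) (p _)]
  simp only [zero_mul, add_zero, add_mul, Finset.sum_add_distrib, hleft, hright]
  ring

theorem hasDerivAt_tripleSum_weight {φ : V → V → V → ℝ} (h₁₂ : ∀ i j k, φ i j k = φ j i k)
    (h₂₃ : ∀ i j k, φ i j k = φ i k j) (p : V → ℝ) :
    HasDerivAt (fun t : ℝ => tripleSum (fun i => w i + t * p i) φ)
      (3 * ∑ i, p i * pairSum w (φ i)) 0 := by
  have hl i := hasDerivAt_add_mul_zero (w i) (p i)
  refine (HasDerivAt.fun_sum fun i _ => HasDerivAt.fun_sum fun j _ => HasDerivAt.fun_sum fun k _ =>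
    (((hl i).mul (hl j)).mul (hl k)).mul_const (φ i j k)).congr_deriv ?_
  have hfst : ∑ i, p i * pairSum w (φ i) = ∑ i, ∑ j, ∑ k, p i * w j * w k * φ i j k := by
    simp only [pairSum, Finset.mul_sum, mul_assoc]
  have hsnd : ∑ i, ∑ j, ∑ k, w i * p j * w k * φ i j k =
      ∑ i, ∑ j, ∑ k, p i * w j * w k * φ i j k := by
    rw [Finset.sum_comm]
    refine Finset.sum_congr rfl fun i _ => Finset.sum_congr rfl fun j _ =>
      Finset.sum_congr rfl fun k _ => ?_
    rw [h₁₂, mul_comm (w j)]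
  have hthd : ∑ i, ∑ j, ∑ k, w i * w j * p k * φ i j k =
      ∑ i, ∑ j, ∑ k, w i * p j * w k * φ i j k := by
    refine Finset.sum_congr rfl fun i _ => ?_
    rw [Finset.sum_comm]
    refine Finset.sum_congr rfl fun j _ => Finset.sum_congr rfl fun k _ => ?_
    rw [h₂₃]
    ring
  simp only [zero_mul, add_zero, Pi.mul_apply, add_mul, Finset.sum_add_distrib, hthd, hsnd, hfst]
  ring

end WeightedSums

/-! ### Step graphons -/

section Graphon

variable {V : Type*} [Fintype V]

/-- The probability that the random graph with edge probabilities `W` has at least two edges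
on `i`, `j`, `k`. -/
def majKernel {V : Type*} (W : V → V → ℝ) (i j k : V) : ℝ := maj3 (W i j) (W j k) (W i k)

/-- The edge density of the weighted graph with vertex weights `w` and edge weights `W`. -/
def edgeDens (w : V → ℝ) (W : V → V → ℝ) : ℝ := pairSum w W

/-- The density of vertex triples spanning at least two edges. -/
def majDens (w : V → ℝ) (W : V → V → ℝ) : ℝ := tripleSum w (majKernel W)

/-- The weighted degree of the vertex `v`. -/
def degree (w : V → ℝ) (W : V → V → ℝ) (v : V) : ℝ := ∑ j, w j * W v j

/-- The density of pairs forming, together with the vertex `v`, a triple with at least two edges. -/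
def rootMaj (w : V → ℝ) (W : V → V → ℝ) (v : V) : ℝ := pairSum w (majKernel W v)

/-- The density of non-adjacent pairs of neighbours of `v`. -/
def openCherry (w : V → ℝ) (W : V → V → ℝ) (v : V) : ℝ :=
  pairSum w fun i j => W v i * W v j * (1 - W i j)

/-- The density of induced paths of length two starting at `v`. -/
def openPath (w : V → ℝ) (W : V → V → ℝ) (v : V) : ℝ :=
  pairSum w fun i j => W v i * (1 - W v j) * W i j

/-- The vertex weights left after deleting the neighbourhood of `v`; they do not sum to one. -/
def antiNbhd {V : Type*} (w : V → ℝ) (W : V → V → ℝ) (v i : V) : ℝ := w i * (1 - W v i)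

/-- A finite step graphon: vertex weights of total mass one and symmetric edge weights in
`[0, 1]`. Loops are allowed: `W i i` is the density inside the class `i`. -/
structure IsGraphon (w : V → ℝ) (W : V → V → ℝ) : Prop where
  nonneg : ∀ i, 0 ≤ w i
  sum_one : ∑ i, w i = 1
  symm : ∀ i j, W i j = W j i
  W_nonneg : ∀ i j, 0 ≤ W i j
  W_le_one : ∀ i j, W i j ≤ 1

variable {w : V → ℝ} {W : V → V → ℝ}

theorem majKernel_swap_left {V : Type*} {W : V → V → ℝ} (hW : ∀ i j, W i j = W j i) (i j k : V) :
    majKernel W i j k = majKernel W j i k := by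
  unfold majKernel maj3
  rw [hW j i]
  ring

theorem majKernel_swap_right {V : Type*} {W : V → V → ℝ} (hW : ∀ i j, W i j = W j i) (i j k : V) :
    majKernel W i j k = majKernel W i k j := by
  unfold majKernel maj3
  rw [hW k j]
  ring

theorem edgeDens_eq_sum_degree (w : V → ℝ) (W : V → V → ℝ) :
    edgeDens w W = ∑ i, w i * degree w W i := pairSum_eq_sum w W

theorem majDens_eq_sum_rootMaj (w : V → ℝ) (W : V → V → ℝ) :
    majDens w W = ∑ i, w i * rootMaj w W i := tripleSum_eq_sum_pairSum w _

theorem edgeDens_mul (w : V → ℝ) (W : V → V → ℝ) (c : ℝ) :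
    edgeDens (fun i => w i * c) W = c ^ 2 * edgeDens w W := by
  rw [edgeDens, pairSum_weight_mul, edgeDens, sq, pairSum_const_mul]

theorem majDens_mul (w : V → ℝ) (W : V → V → ℝ) (c : ℝ) :
    majDens (fun i => w i * c) W = c ^ 3 * majDens w W := by
  rw [majDens, tripleSum_weight_mul, tripleSum_const_mul, majDens]
  ring

theorem degree_sq (w : V → ℝ) (W : V → V → ℝ) (v : V) :
    degree w W v ^ 2 = pairSum w fun i j => W v i * W v j := by
  rw [pairSum_mul, sq, degree]

theorem rootMaj_eq (hW : ∀ i j, W i j = W j i) (v : V) :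
    rootMaj w W v = degree w W v ^ 2 + 2 * openPath w W v := by
  rw [degree_sq, openPath, ← pairSum_const_mul, ← pairSum_add]
  refine pairSum_congr_of_add_swap fun i j => ?_
  unfold majKernel maj3
  rw [hW j i]
  ring

theorem sum_nbhd_degree (w : V → ℝ) (W : V → V → ℝ) (v : V) :
    ∑ i, w i * W v i * degree w W i = degree w W v ^ 2 - openCherry w W v + openPath w W v := by
  have hsum : ∑ i, w i * W v i * degree w W i = pairSum w fun i j => W v i * W i j := by
    simp only [pairSum_eq_sum, degree, Finset.mul_sum, mul_assoc, mul_left_comm (W v _)]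
  rw [hsum, degree_sq, openCherry, openPath, ← pairSum_sub, ← pairSum_add]
  congr 1
  funext i j
  ring

theorem edgeDens_antiNbhd (hW : ∀ i j, W i j = W j i) (v : V) :
    edgeDens (antiNbhd w W v) W =
      edgeDens w W - degree w W v ^ 2 + openCherry w W v - 2 * openPath w W v := by
  unfold edgeDens antiNbhd
  rw [pairSum_weight_mul, degree_sq, openCherry, openPath, ← pairSum_const_mul, ← pairSum_sub,
    ← pairSum_add, ← pairSum_sub]
  refine pairSum_congr_of_add_swap fun i j => ?_
  rw [hW j i]
  ring

theorem sum_openCherry (hW : ∀ i j, W i j = W j i) :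
    ∑ v, w v * openCherry w W v = ∑ v, w v * openPath w W v := by
  unfold openCherry openPath
  rw [← tripleSum_eq_sum_pairSum w fun v i j => W v i * W v j * (1 - W i j),
    ← tripleSum_eq_sum_pairSum w fun v i j => W v i * (1 - W v j) * W i j]
  refine tripleSum_congr_of_permSum fun i j k => ?_
  simp only [permSum]
  rw [hW j i, hW k i, hW k j]
  ring

namespace IsGraphon

theorem one_sub_nonneg (h : IsGraphon w W) (i j : V) : 0 ≤ 1 - W i j :=
  sub_nonneg.2 (h.W_le_one i j)

theorem weight_le_one (h : IsGraphon w W) (i : V) : w i ≤ 1 :=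
  h.sum_one ▸ Finset.single_le_sum (fun j _ => h.nonneg j) (Finset.mem_univ i)

theorem edgeDens_nonneg (h : IsGraphon w W) : 0 ≤ edgeDens w W :=
  pairSum_nonneg h.nonneg h.W_nonneg

theorem edgeDens_le_one (h : IsGraphon w W) : edgeDens w W ≤ 1 := by
  have hcompl := pairSum_nonneg h.nonneg h.one_sub_nonneg
  rw [pairSum_sub, pairSum_const h.sum_one] at hcompl
  exact sub_nonneg.1 hcompl

theorem openCherry_nonneg (h : IsGraphon w W) (v : V) : 0 ≤ openCherry w W v :=
  pairSum_nonneg h.nonneg fun i j =>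
    mul_nonneg (mul_nonneg (h.W_nonneg v i) (h.W_nonneg v j)) (h.one_sub_nonneg i j)

theorem antiNbhd_nonneg (h : IsGraphon w W) (v i : V) : 0 ≤ antiNbhd w W v i :=
  mul_nonneg (h.nonneg i) (h.one_sub_nonneg v i)

theorem sum_antiNbhd (h : IsGraphon w W) (v : V) :
    ∑ i, antiNbhd w W v i = 1 - degree w W v := by
  simp only [antiNbhd, mul_sub, mul_one, Finset.sum_sub_distrib, h.sum_one, degree]

theorem sq_edgeDens_le (h : IsGraphon w W) : edgeDens w W ^ 2 ≤ majDens w W := by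
  have hjensen : edgeDens w W ^ 2 ≤ ∑ i, w i * degree w W i ^ 2 := by
    rw [edgeDens_eq_sum_degree]
    exact Real.pow_arith_mean_le_arith_mean_pow_of_even _ w (degree w W)
      (fun i _ => h.nonneg i) h.sum_one even_two
  have hroot : ∑ i, w i * degree w W i ^ 2 ≤ majDens w W := by
    rw [majDens_eq_sum_rootMaj]
    refine Finset.sum_le_sum fun i _ => mul_le_mul_of_nonneg_left ?_ (h.nonneg i)
    rw [rootMaj_eq h.symm]
    have hpath : 0 ≤ openPath w W i := pairSum_nonneg h.nonneg fun j k =>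
      mul_nonneg (mul_nonneg (h.W_nonneg i j) (h.one_sub_nonneg i k)) (h.W_nonneg j k)
    linarith
  exact hjensen.trans hroot

theorem half_three_mul_edgeDens_sub_one_le (h : IsGraphon w W) :
    (3 * edgeDens w W - 1) / 2 ≤ majDens w W := by
  have hlin : tripleSum w (fun _ j k => (3 * W j k - 1) / 2) = (3 * edgeDens w W - 1) / 2 := by
    simp only [div_eq_inv_mul]
    rw [tripleSum_const_mul, tripleSum_eq_sum_pairSum, ← Finset.sum_mul, h.sum_one, one_mul,
      pairSum_sub, pairSum_const_mul, pairSum_const h.sum_one, edgeDens]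
  rw [← hlin, majDens]
  refine tripleSum_le_of_permSum_le h.nonneg fun i j k => ?_
  have hbool : 0 ≤ (1 - W i j) * (1 - W j k) * (1 - W i k) + W i j * W j k * (1 - W i k) +
      W j k * W i k * (1 - W i j) + W i k * W i j * (1 - W j k) := by
    have := h.W_nonneg i j
    have := h.W_nonneg j k
    have := h.W_nonneg i k
    have := h.one_sub_nonneg i j
    have := h.one_sub_nonneg j k
    have := h.one_sub_nonneg i k
    positivity
  simp only [permSum, majKernel, maj3]
  rw [h.symm j i, h.symm k i, h.symm k j]
  linarith

theorem exists_openCherry_le_openPath (h : IsGraphon w W) :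
    ∃ v, 0 < w v ∧ openCherry w W v ≤ openPath w W v := by
  by_contra! hlt
  obtain ⟨u, -, hu⟩ : ∃ u ∈ Finset.univ, 0 < w u := by
    apply Finset.exists_lt_of_sum_lt (f := fun _ => (0 : ℝ))
    simp only [Finset.sum_const_zero, h.sum_one, zero_lt_one]
  refine (sum_openCherry h.symm).not_gt (Finset.sum_lt_sum (fun v _ => ?_)
    ⟨u, Finset.mem_univ u, mul_lt_mul_of_pos_left (hlt u hu) hu⟩)
  rcases (h.nonneg v).eq_or_lt with hv | hv
  · rw [← hv, zero_mul, zero_mul]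
  · exact (mul_lt_mul_of_pos_left (hlt v hv) hv).le

end IsGraphon

end Graphon

/-! ### Extremal graphons -/

section Extremal

variable {V : Type*} [Fintype V] {w : V → ℝ} {W : V → V → ℝ}

/-- The density of triples `i`, `j`, `k` with `i`, `j` non-adjacent neighbours of `v` and `k`
adjacent to exactly one of `i`, `j`: joining all non-adjacent neighbours of `v` increases `majDens`
at rate `3 * cherryGain`. -/
def cherryGain (w : V → ℝ) (W : V → V → ℝ) (v : V) : ℝ :=
  tripleSum w fun i j k => W v i * W v j * (1 - W i j) * (W i k + W j k - 2 * (W i k * W j k))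

theorem degree_pow_three (w : V → ℝ) (W : V → V → ℝ) (v : V) :
    degree w W v ^ 3 = tripleSum w fun i j k => W v i * (W v j * W v k) := by
  rw [tripleSum_mul w (W v) fun j k => W v j * W v k, ← degree_sq, pow_succ', degree]

theorem degree_mul_openPath (w : V → ℝ) (W : V → V → ℝ) (v : V) :
    degree w W v * openPath w W v =
      tripleSum w fun i j k => W v i * (W v j * (1 - W v k) * W j k) := by
  rw [tripleSum_mul w (W v) fun j k => W v j * (1 - W v k) * W j k, degree, openPath]

theorem IsGraphon.majDens_antiNbhd_le (h : IsGraphon w W) (v : V) :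
    majDens (antiNbhd w W v) W ≤ majDens w W - 3 * ∑ i, w i * W v i * rootMaj w W i +
      2 * degree w W v ^ 3 + 6 * (degree w W v * openPath w W v) - 3 * cherryGain w W v := by
  unfold rootMaj majDens antiNbhd
  rw [tripleSum_weight_mul, ← tripleSum_left_mul w (W v), degree_pow_three, degree_mul_openPath,
    cherryGain, ← tripleSum_const_mul, ← tripleSum_const_mul, ← tripleSum_const_mul,
    ← tripleSum_const_mul, ← tripleSum_sub, ← tripleSum_add, ← tripleSum_add, ← tripleSum_sub]
  refine tripleSum_le_of_permSum_le h.nonneg fun i j k => ?_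
  -- inclusion-exclusion over the neighbours of `v` is off by these four configurations
  have hslack : 0 ≤ W v i * W v j * (1 - W v k) * (W i k * W j k) +
      W v i * W v k * (1 - W v j) * (W i j * W j k) +
      W v j * W v k * (1 - W v i) * (W i j * W i k) +
      2 * (W v i * W v j * W v k * ((1 - W i j) * (1 - W j k) * (1 - W i k))) := by
    have := h.W_nonneg i j
    have := h.W_nonneg j k
    have := h.W_nonneg i k
    have := h.one_sub_nonneg i j
    have := h.one_sub_nonneg j k
    have := h.one_sub_nonneg i k
    have := h.W_nonneg v i
    have := h.W_nonneg v j
    have := h.W_nonneg v k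
    have := h.one_sub_nonneg v i
    have := h.one_sub_nonneg v j
    have := h.one_sub_nonneg v k
    positivity
  simp only [permSum, majKernel, maj3]
  rw [h.symm j i, h.symm k i, h.symm k j]
  linarith

theorem hasDerivAt_edgeDens_edge (w : V → ℝ) (W H : V → V → ℝ) :
    HasDerivAt (fun t : ℝ => edgeDens w (fun i j => W i j + t * H i j)) (edgeDens w H) 0 :=
  HasDerivAt.fun_sum fun i _ => HasDerivAt.fun_sum fun j _ =>
    (hasDerivAt_add_mul_zero (W i j) (H i j)).const_mul (w i * w j)

theorem hasDerivAt_majDens_edge (w : V → ℝ) (hW : ∀ i j, W i j = W j i) {H : V → V → ℝ}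
    (hH : ∀ i j, H i j = H j i) :
    HasDerivAt (fun t : ℝ => majDens w (fun i j => W i j + t * H i j))
      (3 * tripleSum w fun i j k => H i j * (W i k + W j k - 2 * (W i k * W j k))) 0 := by
  have hline i j := hasDerivAt_add_mul_zero (W i j) (H i j)
  have hmaj i j k := ((((hline i j).mul (hline j k)).add ((hline j k).mul (hline i k))).add
    ((hline i k).mul (hline i j))).sub ((((hline i j).const_mul 2).mul (hline j k)).mul (hline i k))
  refine (HasDerivAt.fun_sum fun i _ => HasDerivAt.fun_sum fun j _ => HasDerivAt.fun_sum fun k _ =>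
    (hmaj i j k).const_mul (w i * w j * w k)).congr_deriv ?_
  change tripleSum w _ = _
  rw [← tripleSum_const_mul]
  refine tripleSum_congr_of_permSum fun i j k => ?_
  simp only [permSum, zero_mul, add_zero, Pi.mul_apply]
  rw [hW j i, hW k i, hW k j, hH j i, hH k i, hH k j]
  ring

theorem nonneg_of_hasDerivAt_of_le {ψ : ℝ → ℝ} {c : ℝ} (h : HasDerivAt ψ c 0)
    (hmin : ∀ t ∈ Set.Icc (0 : ℝ) 1, ψ 0 ≤ ψ t) : 0 ≤ c := by
  have hslope := (hasDerivAt_iff_tendsto_slope_zero.1 h).mono_left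
    (nhdsWithin_mono (s := Set.Ioi 0) (t := {0}ᶜ) 0 fun x hx => ne_of_gt hx)
  refine ge_of_tendsto hslope ?_
  filter_upwards [Ioo_mem_nhdsGT (zero_lt_one (α := ℝ))] with t ht
  rw [zero_add, smul_eq_mul]
  exact mul_nonneg (inv_nonneg.2 ht.1.le) (sub_nonneg.2 (hmin t ⟨ht.1.le, ht.2.le⟩))

/-- A graphon minimising `majDens - f edgeDens` among the graphons on the same vertex set. -/
structure IsExtremal (f : ℝ → ℝ) (w : V → ℝ) (W : V → V → ℝ) : Prop
    extends IsGraphon w W where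
  min : ∀ (w' : V → ℝ) (W' : V → V → ℝ), IsGraphon w' W' →
    majDens w W - f (edgeDens w W) ≤ majDens w' W' - f (edgeDens w' W')

theorem isClosed_setOf_isGraphon :
    IsClosed {p : (V → ℝ) × (V → V → ℝ) | IsGraphon p.1 p.2} := by
  have hset : {p : (V → ℝ) × (V → V → ℝ) | IsGraphon p.1 p.2} =
      {p | ∀ i, 0 ≤ p.1 i} ∩ {p | ∑ i, p.1 i = 1} ∩ {p | ∀ i j, p.2 i j = p.2 j i} ∩
        {p | ∀ i j, 0 ≤ p.2 i j} ∩ {p | ∀ i j, p.2 i j ≤ 1} :=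
    Set.ext fun p => ⟨fun h => ⟨⟨⟨⟨h.1, h.2⟩, h.3⟩, h.4⟩, h.5⟩,
      fun h => ⟨h.1.1.1.1, h.1.1.1.2, h.1.1.2, h.1.2, h.2⟩⟩
  rw [hset]
  simp only [Set.ofPred_forall]
  refine ((((isClosed_iInter fun i => ?_).inter ?_).inter
    (isClosed_iInter fun i => isClosed_iInter fun j => ?_)).inter
    (isClosed_iInter fun i => isClosed_iInter fun j => ?_)).inter
    (isClosed_iInter fun i => isClosed_iInter fun j => ?_)
  · exact isClosed_le (by fun_prop) (by fun_prop)
  · exact isClosed_eq (by fun_prop) (by fun_prop)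
  · exact isClosed_eq (by fun_prop) (by fun_prop)
  · exact isClosed_le (by fun_prop) (by fun_prop)
  · exact isClosed_le (by fun_prop) (by fun_prop)

theorem isCompact_setOf_isGraphon :
    IsCompact {p : (V → ℝ) × (V → V → ℝ) | IsGraphon p.1 p.2} := by
  refine IsCompact.of_isClosed_subset (isCompact_Icc.prod isCompact_Icc :
    IsCompact (Set.Icc (0 : V → ℝ) 1 ×ˢ Set.Icc (0 : V → V → ℝ) 1)) isClosed_setOf_isGraphon ?_
  exact fun p hp => ⟨⟨hp.nonneg, hp.weight_le_one⟩, hp.W_nonneg, hp.W_le_one⟩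

theorem IsGraphon.exists_isExtremal (h : IsGraphon w W) {f : ℝ → ℝ}
    (hf : ContinuousOn f (Set.Icc 0 1)) :
    ∃ (w₀ : V → ℝ) (W₀ : V → V → ℝ), IsExtremal f w₀ W₀ := by
  have hedge : Continuous fun p : (V → ℝ) × (V → V → ℝ) => edgeDens p.1 p.2 := by
    unfold edgeDens pairSum
    fun_prop
  have hmaj : Continuous fun p : (V → ℝ) × (V → V → ℝ) => majDens p.1 p.2 := by
    unfold majDens tripleSum majKernel maj3
    fun_prop
  have hcont : ContinuousOn (fun p : (V → ℝ) × (V → V → ℝ) =>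
      majDens p.1 p.2 - f (edgeDens p.1 p.2)) {p | IsGraphon p.1 p.2} :=
    hmaj.continuousOn.sub (hf.comp hedge.continuousOn
      fun p (hp : IsGraphon p.1 p.2) => ⟨hp.edgeDens_nonneg, hp.edgeDens_le_one⟩)
  obtain ⟨p, hp, hmin⟩ := isCompact_setOf_isGraphon.exists_isMinOn ⟨(w, W), h⟩ hcont
  exact ⟨p.1, p.2, hp, fun w' W' h' => hmin (a := (w', W')) h'⟩

theorem IsGraphon.shift_mass [DecidableEq V] (h : IsGraphon w W) {v : V} {t : ℝ} (ht : t ≤ 1)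
    (hvt : -w v ≤ t) : IsGraphon (fun i => w i + t * ((if i = v then 1 else 0) - w i)) W := by
  refine ⟨fun i => ?_, ?_, h.symm, h.W_nonneg, h.W_le_one⟩
  · have hscale := mul_nonneg (h.nonneg i) (sub_nonneg.2 ht)
    split_ifs with hi
    · subst hi
      have hprod := mul_nonneg (neg_le_iff_add_nonneg.1 hvt) (sub_nonneg.2 (h.weight_le_one i))
      linarith [sq_nonneg (w i)]
    · linarith
  · simp only [Finset.sum_add_distrib, ← Finset.mul_sum, Finset.sum_sub_distrib, h.sum_one,
      Finset.sum_ite_eq', Finset.mem_univ, if_true, sub_self, mul_zero, add_zero]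

theorem IsGraphon.join_nbhd (h : IsGraphon w W) (v : V) {t : ℝ} (h₀ : 0 ≤ t) (h₁ : t ≤ 1) :
    IsGraphon w fun i j => W i j + t * (W v i * W v j * (1 - W i j)) := by
  have hfrac i j : t * (W v i * W v j) ∈ Set.Icc 0 1 :=
    ⟨mul_nonneg h₀ (mul_nonneg (h.W_nonneg v i) (h.W_nonneg v j)),
      mul_le_one₀ h₁ (mul_nonneg (h.W_nonneg v i) (h.W_nonneg v j))
        (mul_le_one₀ (h.W_le_one v i) (h.W_nonneg v j) (h.W_le_one v j))⟩
  refine ⟨h.nonneg, h.sum_one, fun i j => ?_, fun i j => ?_, fun i j => ?_⟩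
  · rw [h.symm i j]
    ring
  · rw [← mul_assoc]
    exact add_nonneg (h.W_nonneg i j) (mul_nonneg (hfrac i j).1 (h.one_sub_nonneg i j))
  · have := mul_le_of_le_one_left (h.one_sub_nonneg i j) (hfrac i j).2
    linarith

namespace IsExtremal

variable {f : ℝ → ℝ} {c : ℝ}

theorem rootMaj_sub_majDens (h : IsExtremal f w W) (hf : HasDerivAt f c (edgeDens w W)) {v : V}
    (hv : 0 < w v) :
    3 * (rootMaj w W v - majDens w W) = 2 * c * (degree w W v - edgeDens w W) := by
  classical
  set p : V → ℝ := fun i => (if i = v then 1 else 0) - w i with hp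
  have hproot : ∑ i, p i * rootMaj w W i = rootMaj w W v - majDens w W := by
    simp [hp, sub_mul, majDens_eq_sum_rootMaj]
  have hpdeg : ∑ i, p i * degree w W i = degree w W v - edgeDens w W := by
    simp [hp, sub_mul, edgeDens_eq_sum_degree]
  have hmaj : HasDerivAt (fun t : ℝ => majDens (fun i => w i + t * p i) W)
      (3 * (rootMaj w W v - majDens w W)) 0 := by
    rw [← hproot]
    exact hasDerivAt_tripleSum_weight (majKernel_swap_left h.symm) (majKernel_swap_right h.symm) p
  have hedge : HasDerivAt (fun t : ℝ => edgeDens (fun i => w i + t * p i) W)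
      (2 * (degree w W v - edgeDens w W)) 0 := by
    rw [← hpdeg]
    exact hasDerivAt_pairSum_weight h.symm p
  have hfcomp := HasDerivAt.comp (0 : ℝ) (h₂ := f) (h₂' := c) (by simpa using hf) hedge
  have hmin : IsLocalMin ((fun t : ℝ => majDens (fun i => w i + t * p i) W) -
      f ∘ fun t => edgeDens (fun i => w i + t * p i) W) 0 := by
    filter_upwards [Icc_mem_nhds (neg_lt_zero.2 hv) one_pos] with t ht
    simpa using h.min _ _ (h.shift_mass ht.2 ht.1)
  have hzero := hmin.hasDerivAt_eq_zero (hmaj.sub hfcomp)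
  linarith

theorem openCherry_le_cherryGain (h : IsExtremal f w W) (hf : HasDerivAt f c (edgeDens w W))
    (v : V) : c * openCherry w W v ≤ 3 * cherryGain w W v := by
  have hsymm i j : W v i * W v j * (1 - W i j) = W v j * W v i * (1 - W j i) := by
    rw [h.symm i j]
    ring
  have hmaj := hasDerivAt_majDens_edge w h.symm hsymm
  have hedge := hasDerivAt_edgeDens_edge w W fun i j => W v i * W v j * (1 - W i j)
  have hfcomp := HasDerivAt.comp (0 : ℝ) (h₂ := f) (h₂' := c) (by simpa using hf) hedge
  refine sub_nonneg.1 (nonneg_of_hasDerivAt_of_le (hmaj.sub hfcomp) fun t ht => ?_)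
  simpa using h.min _ _ (h.join_nbhd v ht.1 ht.2)

theorem sum_nbhd_rootMaj (h : IsExtremal f w W) (hf : HasDerivAt f c (edgeDens w W)) (v : V) :
    3 * ∑ i, w i * W v i * rootMaj w W i = 3 * (majDens w W * degree w W v) +
      2 * c * (degree w W v ^ 2 - openCherry w W v + openPath w W v -
        edgeDens w W * degree w W v) := by
  rw [← sum_nbhd_degree, degree]
  simp only [Finset.mul_sum, ← Finset.sum_sub_distrib, ← Finset.sum_add_distrib]
  refine Finset.sum_congr rfl fun i _ => ?_
  rcases (h.nonneg i).eq_or_lt with hi | hi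
  · rw [← hi]
    ring
  · linear_combination w i * W v i * h.rootMaj_sub_majDens hf hi

/-- Replacing the neighbourhood of `v` by a clique of the same weight that is disconnected from
all other vertices does not increase the Lagrangian `majDens - c * edgeDens`. -/
theorem lagrangian_antiNbhd_le (h : IsExtremal f w W) (hf : HasDerivAt f c (edgeDens w W)) {v : V}
    (hv : 0 < w v) :
    majDens (antiNbhd w W v) W + degree w W v ^ 3 -
        c * (edgeDens (antiNbhd w W v) W + degree w W v ^ 2) ≤
      majDens w W - c * edgeDens w W := by
  have hroot := h.rootMaj_sub_majDens hf hv
  rw [rootMaj_eq h.symm] at hroot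
  have hanti := h.majDens_antiNbhd_le v
  rw [h.sum_nbhd_rootMaj hf] at hanti
  rw [edgeDens_antiNbhd h.symm]
  have hgain := h.openCherry_le_cherryGain hf v
  linear_combination hanti + hgain + degree w W v * hroot

end IsExtremal

end Extremal

theorem replacement_shift {k x y e h Y : ℝ} (hk : 1 ≤ k) (he : 0 < e) (heh : e < h)
    (hxy : k * x + y = e) (hyx : y ≤ x + h) (hY₀ : 0 ≤ Y) (hY₁ : Y ≤ e * (h - e))
    (hquad : 2 * h * y = e ^ 2 + k * x ^ 2 + y ^ 2 + Y) : 0 ≤ x ∧ 0 ≤ y ∧ y ≤ e := by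
  have hk₀ : 0 < k := one_pos.trans_le hk
  have hy : 0 ≤ y := by
    have hrhs : 0 ≤ 2 * h * y := by
      rw [hquad]
      positivity
    exact nonneg_of_mul_nonneg_right hrhs (by linarith)
  have hye : y ≤ e := by
    by_contra! hlt
    have hsq : k * x ^ 2 = -(x * (y - e)) := by linear_combination x * hxy
    have hx : x ≤ 0 := nonpos_of_mul_nonpos_right (show k * x ≤ 0 by linarith) hk₀
    have hshift : (y - e) * (y - e - x) ≤ (y - e) * (h - e) :=
      mul_le_mul_of_nonneg_left (by linarith [hx]) (by linarith)
    have hpos : 0 < y * (h - e) := mul_pos (he.trans hlt) (sub_pos.2 heh)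
    linarith
  exact ⟨nonneg_of_mul_nonneg_right (show 0 ≤ k * x by linarith) hk₀, hy, hye⟩

theorem replacement_cubic_le {k x y e h : ℝ} (hk : 0 ≤ k) (heh : e ≤ h)
    (hx : 0 ≤ x) (hy : 0 ≤ y) (hye : y ≤ e) :
    y ^ 2 * (3 * h - 2 * y) ≤ e ^ 2 * (3 * h - 2 * e) + k * x ^ 2 * (3 * h + 2 * x) := by
  have hfactor : 0 ≤ 3 * h * (e + y) - 2 * (e ^ 2 + e * y + y ^ 2) := by
    nlinarith [mul_nonneg (hy.trans hye) (sub_nonneg.2 heh),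
      mul_nonneg hy (sub_nonneg.2 (hye.trans heh)),
      mul_nonneg (hy.trans hye) (sub_nonneg.2 (hye.trans heh)),
      mul_nonneg hy (sub_nonneg.2 heh)]
  have hmono := mul_nonneg (sub_nonneg.2 hye) hfactor
  have hh : 0 ≤ h := (hy.trans hye).trans heh
  have hcube : 0 ≤ k * x ^ 2 * (3 * h + 2 * x) := by positivity
  linarith

namespace IsCliqueProfile

variable {k : ℕ} {a b D R d : ℝ}

theorem lt_replaced_lt (hba : b < a) (hlow : d - (a + b) * D + a * b < R) (hup : R ≤ d - D ^ 2) :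
    b < D ∧ D < a := by
  have hprod : 0 < (a - D) * (D - b) := by linarith
  rcases pos_and_pos_or_neg_and_neg_of_mul_pos hprod with ⟨hD₁, hD₂⟩ | ⟨hD₁, hD₂⟩
  · exact ⟨sub_pos.1 hD₂, sub_pos.1 hD₁⟩
  · linarith

theorem sq_one_sub_le_succ_mul (h : IsCliqueProfile (k + 1) a b) (hba : b < a)
    (hd : (k + 1) * a ^ 2 + b ^ 2 = d) (hlow : d - (a + b) * D + a * b < R)
    (hup : R ≤ d - D ^ 2) : (1 - D) ^ 2 ≤ (k + 1) * R := by
  obtain ⟨hbD, hDa⟩ := lt_replaced_lt hba hlow hup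
  have hmass : (k + 1) * a + b = 1 := by exact_mod_cast h.mass
  have hgap : (k + 1) * (d - (a + b) * D + a * b) - (1 - D) ^ 2 =
      k * ((a - b) * (D - b)) + (a - D) * (D - b) := by
    rw [← hd]
    linear_combination ((k + 1) * a + b + 1 - 2 * D) * hmass
  have hgap_nonneg : 0 ≤ k * ((a - b) * (D - b)) + (a - D) * (D - b) := by
    have := sub_pos.2 hba
    have := sub_pos.2 hbD
    have := sub_pos.2 hDa
    positivity
  have hscale := mul_le_mul_of_nonneg_left hlow.le (show (0 : ℝ) ≤ k + 1 by positivity)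
  linarith

theorem mul_le_sq_one_sub (h : IsCliqueProfile (k + 1) a b)
    (hd : (k + 1) * a ^ 2 + b ^ 2 = d) (hup : R ≤ d - D ^ 2) : k * R ≤ (1 - D) ^ 2 := by
  have hdens : (k + 1) * d ≤ 1 := by
    rw [← hd]
    exact_mod_cast h.mul_density_le_one
  have hscale : k * R ≤ k * (d - D ^ 2) := mul_le_mul_of_nonneg_left hup k.cast_nonneg
  refine hscale.trans (le_of_mul_le_mul_left ?_ (show (0 : ℝ) < k + 1 by positivity))
  linarith [mul_le_mul_of_nonneg_left hdens k.cast_nonneg, sq_nonneg ((k + 1) * D - 1)]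

theorem replacement_le {α β : ℝ} (h : IsCliqueProfile (k + 1) a b) (hk : 1 ≤ k) (hba : b < a)
    (hd : (k + 1) * a ^ 2 + b ^ 2 = d) (hlow : d - (a + b) * D + a * b < R) (hup : R ≤ d - D ^ 2)
    (hβα : β ≤ α) (hmass : k * α + β = 1 - D) (hR : k * α ^ 2 + β ^ 2 = R) :
    (k + 1) * a ^ 3 + b ^ 3 - 3 / 2 * (a + b) * d ≤
      k * α ^ 3 + β ^ 3 + D ^ 3 - 3 / 2 * (a + b) * (R + D ^ 2) := by
  obtain ⟨hbD, hDa⟩ := lt_replaced_lt hba hlow hup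
  have hshift : k * (α - a) + (β - b) = a - D := by
    have hone : (k + 1) * a + b = 1 := by exact_mod_cast h.mass
    linarith
  obtain ⟨hα, hβ, hβD⟩ := replacement_shift (h := a - b) (Y := d - D ^ 2 - R)
    (by exact_mod_cast hk) (sub_pos.2 hDa) (by linarith) hshift (by linarith) (by linarith)
    (by linarith) (by
      rw [← hR, ← hd]
      linear_combination 2 * a * hshift)
  have hcubic := replacement_cubic_le k.cast_nonneg (show a - D ≤ a - b by linarith) hα hβ hβD
  rw [← hR, ← hd]
  linear_combination hcubic / 2 + 3 * a * b * hshift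

theorem cliqueBound_replacement (h : IsCliqueProfile (k + 1) a b) (hk : 1 ≤ k) (hba : b < a)
    (hd : (k + 1) * a ^ 2 + b ^ 2 = d) (hlow : d - (a + b) * D + a * b < R)
    (hup : R ≤ d - D ^ 2) :
    cliqueBound d - 3 / 2 * (a + b) * d ≤
      (1 - D) ^ 3 * cliqueBound (R / (1 - D) ^ 2) + D ^ 3 - 3 / 2 * (a + b) * (R + D ^ 2) := by
  have hD : 0 < 1 - D := sub_pos.2 ((lt_replaced_lt hba hlow hup).2.trans_le h.le_one)
  obtain ⟨α, β, hprofile, hdens⟩ := exists_isCliqueProfile_of_mem_piece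
    (d := R / (1 - D) ^ 2) hk
    (by
      rw [← mul_div_assoc, one_le_div₀ (by positivity)]
      exact h.sq_one_sub_le_succ_mul hba hd hlow hup)
    (by
      rw [← mul_div_assoc, div_le_one₀ (by positivity)]
      exact h.mul_le_sq_one_sub hd hup)
  have hcube : cliqueBound d = (k + 1) * a ^ 3 + b ^ 3 := by
    rw [← hd]
    exact_mod_cast h.cliqueBound_density
  rw [eq_div_iff (by positivity)] at hdens
  have hrepl := h.replacement_le hk hba hd hlow hup
    (mul_le_mul_of_nonneg_left hprofile.le hD.le)
    (by linear_combination (1 - D) * hprofile.mass) (by linear_combination hdens)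
  rw [← hdens, mul_div_cancel_right₀ _ (by positivity), hprofile.cliqueBound_density, hcube]
  rw [← hdens] at hrepl
  linear_combination hrepl

end IsCliqueProfile

section CliqueBound

variable {V : Type*} [Fintype V] {w : V → ℝ} {W : V → V → ℝ}

theorem IsGraphon.exists_isCliqueProfile_of_majDens_lt (h : IsGraphon w W)
    (hlt : majDens w W < cliqueBound (edgeDens w W)) :
    ∃ (k : ℕ) (a b : ℝ), 1 ≤ k ∧ IsCliqueProfile (k + 1) a b ∧ 0 < b ∧ b < a ∧
      (k + 1) * a ^ 2 + b ^ 2 = edgeDens w W := by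
  have hsq := h.sq_edgeDens_le
  have hpos : 0 < edgeDens w W := h.edgeDens_nonneg.lt_of_ne fun h₀ => by
    rw [← h₀, cliqueBound_zero] at hlt
    rw [← h₀] at hsq
    linarith
  obtain ⟨k, a, b, hprofile, hd⟩ := exists_isCliqueProfile hpos h.edgeDens_le_one
  rw [← hd, hprofile.cliqueBound_density] at hlt
  have hne : k * a * b * (a - b) ^ 2 ≠ 0 := by
    rw [← hprofile.triple_sub_sq_density, hd]
    exact (sub_pos.2 (hsq.trans_lt hlt)).ne'
  have hb : 0 < b := hprofile.nonneg.lt_of_ne fun hb => hne (by rw [← hb]; ring)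
  have hba : b < a := hprofile.le.lt_of_ne fun hba => hne (by rw [hba]; ring)
  obtain ⟨k, rfl⟩ : ∃ l, k = l + 1 := ⟨k - 1, by have := hprofile.one_le; omega⟩
  refine ⟨k, a, b, Nat.one_le_iff_ne_zero.2 ?_, hprofile, hb, hba, by exact_mod_cast hd⟩
  rintro rfl
  have hlin := h.half_three_mul_edgeDens_sub_one_le
  have hmass := hprofile.mass
  rw [hprofile.triple_eq, hd] at hlt
  push_cast at hd hmass
  obtain rfl : b = 1 - a := by linarith
  linarith

theorem IsExtremal.le_majDens_of_sum_eq {f : ℝ → ℝ} (h : IsExtremal f w W) {u : V → ℝ} {m : ℝ}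
    (hu : ∀ i, 0 ≤ u i) (hsum : ∑ i, u i = m) (hm : 0 < m) :
    m ^ 3 * (f (edgeDens u W / m ^ 2) + (majDens w W - f (edgeDens w W))) ≤ majDens u W := by
  have hnormal : IsGraphon (fun i => u i * m⁻¹) W :=
    ⟨fun i => mul_nonneg (hu i) (inv_nonneg.2 hm.le),
      by rw [← Finset.sum_mul, hsum, mul_inv_cancel₀ hm.ne'], h.symm, h.W_nonneg, h.W_le_one⟩
  have hmin := h.min _ _ hnormal
  rw [edgeDens_mul, majDens_mul, inv_pow, inv_pow, ← div_eq_inv_mul, ← div_eq_inv_mul,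
    le_sub_iff_add_le', le_div_iff₀ (by positivity), mul_comm] at hmin
  exact hmin

theorem IsExtremal.cliqueBound_le (h : IsExtremal cliqueBound w W) :
    cliqueBound (edgeDens w W) ≤ majDens w W := by
  by_contra! hlt
  obtain ⟨k, a, b, hk, hprofile, hb, hba, hd⟩ := h.exists_isCliqueProfile_of_majDens_lt hlt
  have hderiv : HasDerivAt cliqueBound (3 / 2 * (a + b)) (edgeDens w W) := by
    have := hprofile.hasDerivAt_cliqueBound hb hba
    rwa [Nat.cast_succ, hd] at this
  have hcube : cliqueBound (edgeDens w W) = (a + b) * edgeDens w W - a * b := by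
    have := hprofile.cliqueBound_density
    rwa [hprofile.triple_eq, Nat.cast_succ, hd] at this
  obtain ⟨v, hv, hcherry⟩ := h.exists_openCherry_le_openPath
  have hroot := h.rootMaj_sub_majDens hderiv hv
  rw [rootMaj_eq h.symm] at hroot
  have hnonneg := h.openCherry_nonneg v
  have hedge := edgeDens_antiNbhd (w := w) h.symm v
  have hlow : edgeDens w W - (a + b) * degree w W v + a * b < edgeDens (antiNbhd w W v) W := by
    linarith
  have hup : edgeDens (antiNbhd w W v) W ≤ edgeDens w W - degree w W v ^ 2 := by linarith
  have hD := IsCliqueProfile.lt_replaced_lt hba hlow hup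
  have hD₁ : 0 < 1 - degree w W v := sub_pos.2 (hD.2.trans_le hprofile.le_one)
  have hreplace := hprofile.cliqueBound_replacement hk hba hd hlow hup
  have hlagrangian := h.lagrangian_antiNbhd_le hderiv hv
  have hscaled := h.le_majDens_of_sum_eq (h.antiNbhd_nonneg v) (h.sum_antiNbhd v) hD₁
  have hshrink : (1 - degree w W v) ^ 3 * (cliqueBound (edgeDens w W) - majDens w W) <
      1 * (cliqueBound (edgeDens w W) - majDens w W) :=
    mul_lt_mul_of_pos_right (pow_lt_one₀ hD₁.le (by linarith) three_ne_zero) (sub_pos.2 hlt)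
  linarith

theorem IsGraphon.cliqueBound_le (h : IsGraphon w W) :
    cliqueBound (edgeDens w W) ≤ majDens w W := by
  obtain ⟨w₀, W₀, hext⟩ := h.exists_isExtremal continuousOn_cliqueBound
  have hmin := hext.min w W h
  have hle := hext.cliqueBound_le
  linarith

end CliqueBound

/-! ### Doubly stochastic measures and copulas -/

/-- Measures on the plane both of whose marginals are Lebesgue measure on `[0, s]`. -/
structure HasUniformMarginals (s : ℝ) (μ : Measure (ℝ × ℝ)) : Prop where
  fst : μ.map Prod.fst = volume.restrict (Set.Icc 0 s)
  snd : μ.map Prod.snd = volume.restrict (Set.Icc 0 s)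

/-- Doubly stochastic measures on the unit square, encoded as measures on the plane. -/
abbrev IsDoublyStochastic (μ : Measure (ℝ × ℝ)) : Prop :=
  HasUniformMarginals 1 μ

/-- Mass of the concordant pairs of points under `μ × μ`. -/
noncomputable def concordance (μ : Measure (ℝ × ℝ)) : ℝ :=
  (μ.prod μ).real {w | 0 < (w.1.1 - w.2.1) * (w.1.2 - w.2.2)}

/-- Mass of the discordant pairs of points under `μ × μ`. -/
noncomputable def discordance (μ : Measure (ℝ × ℝ)) : ℝ :=
  (μ.prod μ).real {w | (w.1.1 - w.2.1) * (w.1.2 - w.2.2) < 0}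

/-- The tau-rho region of doubly stochastic measures. Such a measure has no ties, so that its
Kendall's tau is twice its concordance minus one. -/
def dsRegion : Set (ℝ × ℝ) :=
  {p | ∃ μ : Measure (ℝ × ℝ), IsDoublyStochastic μ ∧
    p = (2 * concordance μ - 1, 12 * (∫ z, z.1 * z.2 ∂μ) - 3)}

theorem measurableSet_concordant :
    MeasurableSet {w : (ℝ × ℝ) × (ℝ × ℝ) | 0 < (w.1.1 - w.2.1) * (w.1.2 - w.2.2)} :=
  measurableSet_lt (by fun_prop) (by fun_prop)

theorem measurableSet_discordant :
    MeasurableSet {w : (ℝ × ℝ) × (ℝ × ℝ) | (w.1.1 - w.2.1) * (w.1.2 - w.2.2) < 0} :=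
  measurableSet_lt (by fun_prop) (by fun_prop)

theorem measureReal_pos_add_measureReal_neg {α : Type*} [MeasurableSpace α] {μ : Measure α}
    [IsFiniteMeasure μ] {f : α → ℝ} (hf : Measurable f) :
    μ.real {a | 0 < f a} + μ.real {a | f a < 0} = μ.real {a | f a ≠ 0} := by
  rw [← measureReal_union _ (measurableSet_lt hf measurable_const)]
  · congr 1
    ext a
    simp only [Set.mem_union, Set.mem_ofPred, ← lt_or_lt_iff_ne, or_comm]
  · exact Set.disjoint_left.2 fun a hpos hneg => lt_asymm (Set.mem_ofPred.1 hpos) hneg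

theorem ae_prod_ne {α : Type*} [MeasurableSpace α] {μ : Measure α} [SFinite μ] {f : α → ℝ}
    (hf : Measurable f) [NullSingletonClass (μ.map f)] : ∀ᵐ w ∂μ.prod μ, f w.1 ≠ f w.2 := by
  change (μ.prod μ) {w | ¬f w.1 ≠ f w.2} = 0
  simp only [not_not]
  rw [Measure.measure_prod_null (measurableSet_eq_fun (by fun_prop) (by fun_prop))]
  refine Filter.Eventually.of_forall fun a => ?_
  have hfiber : μ (f ⁻¹' {f a}) = 0 := by
    rw [← Measure.map_apply hf (measurableSet_singleton _), measure_singleton]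
  exact measure_mono_null (fun b hb => Eq.symm hb) hfiber

instance isProbabilityMeasure_uniform :
    IsProbabilityMeasure (volume.restrict (Set.Icc (0 : ℝ) 1)) := ⟨by simp⟩

theorem uniform_Iic {t : ℝ} (ht : t ∈ Set.Icc (0 : ℝ) 1) :
    (volume.restrict (Set.Icc (0 : ℝ) 1)) (Set.Iic t) = ENNReal.ofReal t := by
  have : Set.Iic t ∩ Set.Icc 0 1 = Set.Icc 0 t := by
    rw [Set.inter_comm, ← Set.Ici_inter_Iic, Set.inter_assoc, Set.Iic_inter_Iic,
      min_eq_right ht.2, Set.Ici_inter_Iic]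
  rw [Measure.restrict_apply measurableSet_Iic, this, Real.volume_Icc, sub_zero]

theorem cdf_eq_clamp {ν : Measure ℝ} [IsProbabilityMeasure ν]
    (h : ∀ t ∈ Set.Icc (0 : ℝ) 1, ν (Set.Iic t) = ENNReal.ofReal t) (x : ℝ) :
    cdf ν x = max 0 (min 1 x) := by
  have hcdf : ∀ t ∈ Set.Icc (0 : ℝ) 1, cdf ν t = t := fun t ht => by
    rw [cdf_eq_real, measureReal_def, h t ht, ENNReal.toReal_ofReal ht.1]
  rcases lt_or_ge x 0 with hx | hx
  · rw [min_eq_right (by linarith), max_eq_left hx.le]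
    exact le_antisymm ((monotone_cdf ν hx.le).trans (hcdf 0 (by simp)).le) (cdf_nonneg _ _)
  rcases le_or_gt x 1 with hx1 | hx1
  · rw [min_eq_right hx1, max_eq_right hx, hcdf x ⟨hx, hx1⟩]
  · rw [min_eq_left hx1.le, max_eq_right zero_le_one]
    exact le_antisymm (cdf_le_one _ _) ((hcdf 1 (by simp)).ge.trans (monotone_cdf ν hx1.le))

theorem cdf_uniform (x : ℝ) :
    cdf (volume.restrict (Set.Icc (0 : ℝ) 1)) x = max 0 (min 1 x) :=
  cdf_eq_clamp (fun _ => uniform_Iic) x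

theorem eq_uniform_of_Iic {ν : Measure ℝ} [IsProbabilityMeasure ν]
    (h : ∀ t ∈ Set.Icc (0 : ℝ) 1, ν (Set.Iic t) = ENNReal.ofReal t) :
    ν = volume.restrict (Set.Icc 0 1) :=
  Measure.eq_of_cdf _ _ (StieltjesFunction.ext fun x => by rw [cdf_eq_clamp h, cdf_uniform])

namespace HasUniformMarginals

variable {s : ℝ} {μ : Measure (ℝ × ℝ)}

theorem isFiniteMeasure (h : HasUniformMarginals s μ) : IsFiniteMeasure μ := by
  have : IsFiniteMeasure (μ.map Prod.fst) := h.fst ▸ inferInstance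
  exact Measure.isFiniteMeasure_of_map measurable_fst.aemeasurable

theorem measureReal_univ (h : HasUniformMarginals s μ) (hs : 0 ≤ s) : μ.real Set.univ = s := by
  rw [← Set.preimage_univ (f := Prod.fst), ← map_measureReal_apply measurable_fst .univ, h.fst,
    measureReal_restrict_apply_univ, Real.volume_real_Icc_of_le hs, sub_zero]

theorem ae_mem (h : HasUniformMarginals s μ) :
    ∀ᵐ z ∂μ, z.1 ∈ Set.Icc 0 s ∧ z.2 ∈ Set.Icc 0 s := by
  have hfst : ∀ᵐ x ∂μ.map Prod.fst, x ∈ Set.Icc 0 s := h.fst ▸ ae_restrict_mem measurableSet_Icc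
  have hsnd : ∀ᵐ x ∂μ.map Prod.snd, x ∈ Set.Icc 0 s := h.snd ▸ ae_restrict_mem measurableSet_Icc
  exact (ae_of_ae_map measurable_fst.aemeasurable hfst).and
    (ae_of_ae_map measurable_snd.aemeasurable hsnd)

theorem ae_ne (h : HasUniformMarginals s μ) :
    ∀ᵐ w ∂(μ.prod μ), w.1.1 ≠ w.2.1 ∧ w.1.2 ≠ w.2.2 := by
  have := h.isFiniteMeasure
  have : NullSingletonClass (μ.map Prod.fst) := h.fst ▸ inferInstance
  have : NullSingletonClass (μ.map Prod.snd) := h.snd ▸ inferInstance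
  exact (ae_prod_ne measurable_fst).and (ae_prod_ne measurable_snd)

theorem concordance_add_discordance (h : HasUniformMarginals s μ) (hs : 0 ≤ s) :
    concordance μ + discordance μ = s ^ 2 := by
  have := h.isFiniteMeasure
  have huniv : (μ.prod μ).real Set.univ = s ^ 2 := by
    rw [← Set.univ_prod_univ, measureReal_prod_prod, h.measureReal_univ hs, sq]
  rw [concordance, discordance, measureReal_pos_add_measureReal_neg (by fun_prop), ← huniv]
  refine measureReal_congr (Filter.eventuallyEq_univ.2 ?_)
  filter_upwards [h.ae_ne] with w hw
  exact mul_ne_zero (sub_ne_zero.2 hw.1) (sub_ne_zero.2 hw.2)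

theorem concordance_eq_two_mul_real_le (h : HasUniformMarginals s μ) :
    concordance μ = 2 * (μ.prod μ).real {w | w.2 ≤ w.1} := by
  have := h.isFiniteMeasure
  have hswap : (μ.prod μ).real {w | w.1 ≤ w.2} = (μ.prod μ).real {w | w.2 ≤ w.1} :=
    Measure.measurePreserving_swap.measureReal_preimage
      (measurableSet_le measurable_snd measurable_fst).nullMeasurableSet
  have hdisj : AEDisjoint (μ.prod μ) {w | w.2 ≤ w.1} {w | w.1 ≤ w.2} := by
    refine measure_eq_zero_iff_ae_notMem.2 ?_
    filter_upwards [h.ae_ne] with w hw hmem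
    exact hw.1 (congrArg Prod.fst (hmem.2.antisymm hmem.1))
  have hconc : ({w | 0 < (w.1.1 - w.2.1) * (w.1.2 - w.2.2)} : Set ((ℝ × ℝ) × (ℝ × ℝ)))
      =ᵐ[μ.prod μ] ({w | w.2 ≤ w.1} ∪ {w | w.1 ≤ w.2} : Set _) := by
    refine Filter.eventuallyEq_set.2 ?_
    filter_upwards [h.ae_ne] with w hw
    simp only [Set.mem_union, Set.mem_ofPred, mul_pos_iff, sub_pos, sub_neg, Prod.le_def,
      hw.1.le_iff_lt, hw.2.le_iff_lt, hw.1.symm.le_iff_lt, hw.2.symm.le_iff_lt]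
  rw [concordance, measureReal_congr hconc, measureReal_union₀
    (measurableSet_le measurable_fst measurable_snd).nullMeasurableSet hdisj, hswap, two_mul]

theorem swap (h : HasUniformMarginals s μ) : HasUniformMarginals s (μ.map Prod.swap) where
  fst := by rw [Measure.map_map measurable_fst measurable_swap]; exact h.snd
  snd := by rw [Measure.map_map measurable_snd measurable_swap]; exact h.fst

theorem integral_fst (h : HasUniformMarginals s μ) (hs : 0 ≤ s) : ∫ z, z.1 ∂μ = s ^ 2 / 2 := by
  have hmap : ∫ x, x ∂μ.map Prod.fst = ∫ z, z.1 ∂μ :=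
    integral_map measurable_fst.aemeasurable (by fun_prop)
  rw [← hmap, h.fst, integral_Icc_eq_integral_Ioc, ← intervalIntegral.integral_of_le hs]
  simp

theorem integral_snd (h : HasUniformMarginals s μ) (hs : 0 ≤ s) : ∫ z, z.2 ∂μ = s ^ 2 / 2 := by
  rw [← h.swap.integral_fst hs, integral_map measurable_swap.aemeasurable (by fun_prop)]
  rfl

theorem integrable_of_continuous (h : HasUniformMarginals s μ) {f : ℝ × ℝ → ℝ}
    (hf : Continuous f) : Integrable f μ := by
  have := h.isFiniteMeasure
  obtain ⟨c, hc⟩ := (isCompact_Icc.prod isCompact_Icc).exists_bound_of_continuousOn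
    (s := Set.Icc 0 s ×ˢ Set.Icc 0 s) hf.continuousOn
  exact Integrable.of_bound hf.aestronglyMeasurable c (h.ae_mem.mono hc)

end HasUniformMarginals

theorem IsDoublyStochastic.isProbabilityMeasure {μ : Measure (ℝ × ℝ)} (h : IsDoublyStochastic μ) :
    IsProbabilityMeasure μ := by
  have : IsProbabilityMeasure (μ.map Prod.fst) := h.fst ▸ isProbabilityMeasure_uniform
  exact Measure.isProbabilityMeasure_of_map Prod.fst

theorem measure_cdf_preimage_Iic (ν : Measure ℝ) [IsProbabilityMeasure ν]
    (hc : Continuous (cdf ν)) {t x : ℝ} (hx : cdf ν x ≤ t) (ht : t < 1) :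
    ν (cdf ν ⁻¹' Set.Iic t) = ENNReal.ofReal t := by
  set S := cdf ν ⁻¹' Set.Iic t
  obtain ⟨b, hb⟩ := ((tendsto_cdf_atTop ν).eventually (lt_mem_nhds ht)).exists
  obtain ⟨y, hy⟩ := mem_range_of_exists_le_of_exists_ge hc ⟨x, hx⟩ ⟨b, hb.le⟩
  have hbdd : BddAbove S :=
    ⟨b, fun z hz => ((monotone_cdf ν).reflect_lt (lt_of_le_of_lt hz hb)).le⟩
  have hsup : sSup S ∈ S := (isClosed_Iic.preimage hc).csSup_mem ⟨x, hx⟩ hbdd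
  have hS : S = Set.Iic (sSup S) :=
    Set.Subset.antisymm (fun z hz => le_csSup hbdd hz)
      fun z hz => (monotone_cdf ν hz).trans hsup
  have hval : cdf ν (sSup S) = t :=
    le_antisymm hsup (hy.symm.le.trans (monotone_cdf ν (le_csSup hbdd hy.le)))
  rw [hS, ← ofReal_cdf, hval]

theorem map_cdf_eq_uniform (ν : Measure ℝ) [IsProbabilityMeasure ν] (hc : Continuous (cdf ν)) :
    ν.map (cdf ν) = volume.restrict (Set.Icc 0 1) := by
  have := Measure.isProbabilityMeasure_map (μ := ν) hc.measurable.aemeasurable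
  refine eq_uniform_of_Iic fun t ht => ?_
  rw [Measure.map_apply hc.measurable measurableSet_Iic]
  rcases ht.2.eq_or_lt with rfl | h1
  · rw [ENNReal.ofReal_one, Set.preimage_eq_univ_iff.2, measure_univ]
    rintro _ ⟨x, rfl⟩
    exact cdf_le_one ν x
  rcases (cdf ν ⁻¹' Set.Iic t).eq_empty_or_nonempty with hempty | ⟨x, hx⟩
  · have h0 : t ≤ 0 := by
      by_contra! hpos
      obtain ⟨x, hx⟩ := ((tendsto_cdf_atBot ν).eventually (gt_mem_nhds hpos)).exists
      exact Set.eq_empty_iff_forall_notMem.1 hempty x hx.le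
    rw [hempty, measure_empty, ENNReal.ofReal_of_nonpos h0]
  · exact measure_cdf_preimage_Iic ν hc hx h1

section MonotoneTransform

variable {S : Type} [MeasurableSpace S] {P : Measure S} [IsProbabilityMeasure P] {X Y : S → ℝ}
  {F G : ℝ → ℝ}

theorem kendallTau_eq_of_monotone (hX : Measurable X) (hY : Measurable Y) (hF : Monotone F)
    (hG : Monotone G) (hμ : IsDoublyStochastic (P.map fun s => (F (X s), G (Y s)))) :
    kendallTau P X Y = 2 * concordance (P.map fun s => (F (X s), G (Y s))) - 1 := by
  set T : S → ℝ × ℝ := fun s => (F (X s), G (Y s)) with hT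
  have hTm : Measurable T := (hF.measurable.comp hX).prodMk (hG.measurable.comp hY)
  have hTT : Measurable (Prod.map T T) := hTm.prodMap hTm
  have hprod : (P.map T).prod (P.map T) = (P.prod P).map (Prod.map T T) :=
    Measure.map_prod_map P P hTm hTm
  have hconc : concordance (P.map T) ≤
      (P.prod P).real {w | 0 < (X w.1 - X w.2) * (Y w.1 - Y w.2)} := by
    rw [concordance, hprod, map_measureReal_apply hTT measurableSet_concordant]
    refine measureReal_mono fun w hw => ?_
    simp only [Set.mem_preimage, Set.mem_ofPred, Prod.map_fst, Prod.map_snd, hT, mul_pos_iff,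
      sub_pos, sub_neg] at hw ⊢
    exact hw.imp (And.imp hF.reflect_lt hG.reflect_lt) (And.imp hF.reflect_lt hG.reflect_lt)
  have hdisc : discordance (P.map T) ≤
      (P.prod P).real {w | (X w.1 - X w.2) * (Y w.1 - Y w.2) < 0} := by
    rw [discordance, hprod, map_measureReal_apply hTT measurableSet_discordant]
    refine measureReal_mono fun w hw => ?_
    simp only [Set.mem_preimage, Set.mem_ofPred, Prod.map_fst, Prod.map_snd, hT, mul_neg_iff,
      sub_pos, sub_neg] at hw ⊢
    exact hw.imp (And.imp hF.reflect_lt hG.reflect_lt) (And.imp hF.reflect_lt hG.reflect_lt)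
  -- Concordance and discordance can only increase, but their sum is already one.
  have hsum : (P.prod P).real {w | 0 < (X w.1 - X w.2) * (Y w.1 - Y w.2)} +
      (P.prod P).real {w | (X w.1 - X w.2) * (Y w.1 - Y w.2) < 0} ≤ 1 :=
    (measureReal_pos_add_measureReal_neg (by fun_prop)).trans_le measureReal_le_one
  rw [kendallTau]
  linarith [hμ.concordance_add_discordance zero_le_one]

theorem isDoublyStochastic_map_cdf (hX : Measurable X) (hY : Measurable Y)
    (hF : Continuous (cdf (P.map X))) (hG : Continuous (cdf (P.map Y))) :
    IsDoublyStochastic (P.map fun s => (cdf (P.map X) (X s), cdf (P.map Y) (Y s))) := by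
  have := Measure.isProbabilityMeasure_map (μ := P) hX.aemeasurable
  have := Measure.isProbabilityMeasure_map (μ := P) hY.aemeasurable
  have hT := (hF.measurable.comp hX).prodMk (hG.measurable.comp hY)
  constructor
  · rw [← map_cdf_eq_uniform (P.map X) hF, Measure.map_map hF.measurable hX]
    exact Measure.map_map measurable_fst hT
  · rw [← map_cdf_eq_uniform (P.map Y) hG, Measure.map_map hG.measurable hY]
    exact Measure.map_map measurable_snd hT

end MonotoneTransform

theorem exactRegion_subset_dsRegion : exactRegion ⊆ dsRegion := by
  rintro p ⟨S, _, P, X, Y, _, hX, hY, hF, hG, rfl⟩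
  have hT : Measurable fun s => (cdf (P.map X) (X s), cdf (P.map Y) (Y s)) :=
    (hF.measurable.comp hX).prodMk (hG.measurable.comp hY)
  have hμ := isDoublyStochastic_map_cdf hX hY hF hG
  refine ⟨_, hμ, Prod.ext (kendallTau_eq_of_monotone hX hY (monotone_cdf _) (monotone_cdf _) hμ) ?_⟩
  rw [spearmanRho, integral_map hT.aemeasurable (by fun_prop)]
  ring

theorem dsRegion_subset_exactRegion : dsRegion ⊆ exactRegion := by
  rintro p ⟨μ, hμ, rfl⟩
  have := hμ.isProbabilityMeasure
  have hcdf : ⇑(cdf (volume.restrict (Set.Icc (0 : ℝ) 1))) = fun x => max 0 (min 1 x) :=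
    funext cdf_uniform
  have hcont : Continuous (cdf (volume.restrict (Set.Icc (0 : ℝ) 1))) := by
    rw [hcdf]; fun_prop
  refine ⟨ℝ × ℝ, inferInstance, μ, Prod.fst, Prod.snd, inferInstance, measurable_fst,
    measurable_snd, hμ.fst ▸ hcont, hμ.snd ▸ hcont, Prod.ext ?_ ?_⟩
  · change 2 * concordance μ - 1 = concordance μ - discordance μ
    linarith [hμ.concordance_add_discordance zero_le_one]
  · have hclamp : ∫ z, max 0 (min 1 z.1) * max 0 (min 1 z.2) ∂μ = ∫ z, z.1 * z.2 ∂μ := by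
      refine integral_congr_ae ?_
      filter_upwards [hμ.ae_mem] with z hz
      rw [min_eq_right hz.1.2, max_eq_right hz.1.1, min_eq_right hz.2.2, max_eq_right hz.2.1]
    simp only [spearmanRho, hμ.fst, hμ.snd, hcdf, hclamp]
    ring

theorem exactRegion_eq_dsRegion : exactRegion = dsRegion :=
  exactRegion_subset_dsRegion.antisymm dsRegion_subset_exactRegion

/-- The inclusion of the unit square into the plane. -/
def squareCoe (z : unitInterval × unitInterval) : ℝ × ℝ := (z.1, z.2)

theorem measurable_squareCoe : Measurable squareCoe := by
  unfold squareCoe; fun_prop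

theorem squareCoe_preimage_Iic_prod_Iic (x y : unitInterval) :
    squareCoe ⁻¹' (Set.Iic (x : ℝ) ×ˢ Set.Iic (y : ℝ)) = Set.Icc 0 x ×ˢ Set.Icc 0 y := by
  ext z
  exact ⟨fun h => ⟨⟨z.1.2.1, h.1⟩, z.2.2.1, h.2⟩, fun h => ⟨h.1.2, h.2.2⟩⟩

section Copula

variable {A : unitInterval → unitInterval → ℝ} {ν : Measure (unitInterval × unitInterval)}

theorem IsMeasureOf.isProbabilityMeasure (hA : IsCopula A) (hν : IsMeasureOf A ν) :
    IsProbabilityMeasure ν := by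
  have huniv : Set.Icc (0 : unitInterval) 1 ×ˢ Set.Icc (0 : unitInterval) 1 = Set.univ :=
    Set.eq_univ_of_forall fun z => ⟨⟨z.1.2.1, z.1.2.2⟩, z.2.2.1, z.2.2.2⟩
  exact ⟨by simpa [huniv, hA.left_one] using hν 1 1⟩

theorem IsMeasureOf.isDoublyStochastic (hA : IsCopula A) (hν : IsMeasureOf A ν) :
    IsDoublyStochastic (ν.map squareCoe) := by
  have := hν.isProbabilityMeasure hA
  have hfst : Measurable (Prod.fst ∘ squareCoe) := measurable_fst.comp measurable_squareCoe
  have hsnd : Measurable (Prod.snd ∘ squareCoe) := measurable_snd.comp measurable_squareCoe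
  constructor
  · rw [Measure.map_map measurable_fst measurable_squareCoe]
    have := Measure.isProbabilityMeasure_map (μ := ν) hfst.aemeasurable
    refine eq_uniform_of_Iic fun t ht => ?_
    rw [Measure.map_apply hfst measurableSet_Iic,
      show ENNReal.ofReal t = _ from congrArg _ (hA.right_one ⟨t, ht⟩).symm, ← hν]
    congr 1
    ext z
    exact ⟨fun hz => ⟨⟨z.1.2.1, hz⟩, z.2.2⟩, fun hz => hz.1.2⟩
  · rw [Measure.map_map measurable_snd measurable_squareCoe]
    have := Measure.isProbabilityMeasure_map (μ := ν) hsnd.aemeasurable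
    refine eq_uniform_of_Iic fun t ht => ?_
    rw [Measure.map_apply hsnd measurableSet_Iic,
      show ENNReal.ofReal t = _ from congrArg _ (hA.left_one ⟨t, ht⟩).symm, ← hν]
    congr 1
    ext z
    exact ⟨fun hz => ⟨z.1.2, ⟨z.2.2.1, hz⟩⟩, fun hz => hz.2.2⟩

theorem IsCopula.nonneg (hA : IsCopula A) (x y : unitInterval) : 0 ≤ A x y := by
  have := hA.two_increasing 0 x 0 y x.2.1 y.2.1
  simpa [hA.left_zero, hA.right_zero] using this

theorem IsMeasureOf.two_mul_integral (hA : IsCopula A) (hν : IsMeasureOf A ν) :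
    2 * ∫ z, A z.1 z.2 ∂ν = concordance (ν.map squareCoe) := by
  have := hν.isProbabilityMeasure hA
  have hmap : Measurable (Prod.map squareCoe squareCoe) :=
    measurable_squareCoe.prodMap measurable_squareCoe
  have hle : MeasurableSet {w : (ℝ × ℝ) × (ℝ × ℝ) | w.2 ≤ w.1} :=
    measurableSet_le measurable_snd measurable_fst
  have hfiber (z : unitInterval × unitInterval) :
      ν (Prod.mk z ⁻¹' (Prod.map squareCoe squareCoe ⁻¹' {w | w.2 ≤ w.1})) =
        ENNReal.ofReal (A z.1 z.2) := by
    rw [← hν, ← squareCoe_preimage_Iic_prod_Iic]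
    rfl
  have hmeas : Measurable fun z : unitInterval × unitInterval => A z.1 z.2 := by
    have := (measurable_measure_prodMk_left (ν := ν) (hmap hle)).ennreal_toReal
    simpa only [hfiber, ENNReal.toReal_ofReal (hA.nonneg _ _)] using this
  rw [(hν.isDoublyStochastic hA).concordance_eq_two_mul_real_le,
    Measure.map_prod_map ν ν measurable_squareCoe measurable_squareCoe,
    map_measureReal_apply hmap hle, measureReal_def, Measure.prod_apply (hmap hle)]
  simp only [hfiber]
  rw [integral_eq_lintegral_of_nonneg_ae (Filter.Eventually.of_forall fun z => hA.nonneg _ _)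
    hmeas.aestronglyMeasurable]

end Copula

theorem copulaRegion_subset_dsRegion : copulaRegion ⊆ dsRegion := by
  rintro p ⟨A, ν, hA, hν, rfl⟩
  refine ⟨ν.map squareCoe, hν.isDoublyStochastic hA, ?_⟩
  rw [integral_map measurable_squareCoe.aemeasurable (by fun_prop), ← hν.two_mul_integral hA]
  exact Prod.ext (by ring) rfl

section DoublyStochasticToCopula

variable {μ : Measure (ℝ × ℝ)}

theorem IsDoublyStochastic.exists_map_squareCoe_eq (hμ : IsDoublyStochastic μ) :
    ∃ ν : Measure (unitInterval × unitInterval), ν.map squareCoe = μ := by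
  set clamp : ℝ × ℝ → unitInterval × unitInterval :=
    Prod.map (Set.projIcc 0 1 zero_le_one) (Set.projIcc 0 1 zero_le_one)
  have hclamp : Measurable clamp := continuous_projIcc.measurable.prodMap
    continuous_projIcc.measurable
  have hid : squareCoe ∘ clamp =ᵐ[μ] id := by
    filter_upwards [hμ.ae_mem] with z hz
    simp only [squareCoe, clamp, Function.comp_apply, Prod.map, Set.projIcc_of_mem _ hz.1,
      Set.projIcc_of_mem _ hz.2, id]
  exact ⟨μ.map clamp, by
    rw [Measure.map_map measurable_squareCoe hclamp, Measure.map_congr hid, Measure.map_id]⟩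

theorem measureReal_Iic_prod_two_increasing [IsFiniteMeasure μ] {x₁ x₂ y₁ y₂ : ℝ} (hx : x₁ ≤ x₂)
    (hy : y₁ ≤ y₂) : 0 ≤ μ.real (Set.Iic x₂ ×ˢ Set.Iic y₂) - μ.real (Set.Iic x₁ ×ˢ Set.Iic y₂) -
      μ.real (Set.Iic x₂ ×ˢ Set.Iic y₁) + μ.real (Set.Iic x₁ ×ˢ Set.Iic y₁) := by
  have hunion := measureReal_union_add_inter (μ := μ) (s := Set.Iic x₁ ×ˢ Set.Iic y₂)
    ((measurableSet_Iic (a := x₂)).prod (measurableSet_Iic (a := y₁)))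
  rw [Set.prod_inter_prod, Set.Iic_inter_Iic, Set.Iic_inter_Iic, min_eq_left hx,
    min_eq_right hy] at hunion
  have hmono : μ.real ((Set.Iic x₁ ×ˢ Set.Iic y₂) ∪ (Set.Iic x₂ ×ˢ Set.Iic y₁)) ≤
      μ.real (Set.Iic x₂ ×ˢ Set.Iic y₂) :=
    measureReal_mono (Set.union_subset (Set.prod_mono (Set.Iic_subset_Iic.2 hx) subset_rfl)
      (Set.prod_mono subset_rfl (Set.Iic_subset_Iic.2 hy)))
  linarith

theorem IsDoublyStochastic.isCopula (hμ : IsDoublyStochastic μ) :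
    IsCopula fun x y => μ.real (Set.Iic (x : ℝ) ×ˢ Set.Iic (y : ℝ)) := by
  have := hμ.isProbabilityMeasure
  have hfst (t : unitInterval) : μ.real (Prod.fst ⁻¹' Set.Iic (t : ℝ)) = t := by
    rw [← map_measureReal_apply measurable_fst measurableSet_Iic, hμ.fst, measureReal_def,
      uniform_Iic t.2, ENNReal.toReal_ofReal t.2.1]
  have hsnd (t : unitInterval) : μ.real (Prod.snd ⁻¹' Set.Iic (t : ℝ)) = t := by
    rw [← map_measureReal_apply measurable_snd measurableSet_Iic, hμ.snd, measureReal_def,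
      uniform_Iic t.2, ENNReal.toReal_ofReal t.2.1]
  refine ⟨fun y => ?_, fun x => ?_, fun y => ?_, fun x => ?_,
    fun x₁ x₂ y₁ y₂ hx hy => measureReal_Iic_prod_two_increasing hx hy⟩
  · exact le_antisymm ((measureReal_mono fun z hz => hz.1).trans (hfst 0).le) measureReal_nonneg
  · exact le_antisymm ((measureReal_mono fun z hz => hz.2).trans (hsnd 0).le) measureReal_nonneg
  · refine (measureReal_congr (Filter.eventuallyEq_set.2 ?_)).trans (hsnd y)
    filter_upwards [hμ.ae_mem] with z hz
    exact ⟨fun h => h.2, fun h => ⟨hz.1.2, h⟩⟩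
  · refine (measureReal_congr (Filter.eventuallyEq_set.2 ?_)).trans (hfst x)
    filter_upwards [hμ.ae_mem] with z hz
    exact ⟨fun h => h.1, fun h => ⟨h, hz.2.2⟩⟩

end DoublyStochasticToCopula

theorem dsRegion_subset_copulaRegion : dsRegion ⊆ copulaRegion := by
  rintro p ⟨μ, hμ, rfl⟩
  have := hμ.isProbabilityMeasure
  obtain ⟨ν, rfl⟩ := hμ.exists_map_squareCoe_eq
  have hν : IsMeasureOf
      (fun x y => (ν.map squareCoe).real (Set.Iic (x : ℝ) ×ˢ Set.Iic (y : ℝ))) ν := fun x y => by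
    rw [ofReal_measureReal, Measure.map_apply measurable_squareCoe
      (measurableSet_Iic.prod measurableSet_Iic), squareCoe_preimage_Iic_prod_Iic]
  refine ⟨_, ν, hμ.isCopula, hν, ?_⟩
  rw [integral_map measurable_squareCoe.aemeasurable (by fun_prop),
    ← hν.two_mul_integral hμ.isCopula]
  exact Prod.ext (by ring) rfl

theorem copulaRegion_eq_exactRegion : copulaRegion = exactRegion :=
  exactRegion_eq_dsRegion ▸ copulaRegion_subset_dsRegion.antisymm dsRegion_subset_copulaRegion

/-! ### Concordance graphs and the lower bound -/

theorem realSign_sub_comm (x y : ℝ) : Real.sign (y - x) = -Real.sign (x - y) := by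
  rw [← neg_sub, Real.sign_neg]

theorem realSign_mul (x y : ℝ) : Real.sign (x * y) = Real.sign x * Real.sign y := by
  rcases lt_trichotomy x 0 with hx | rfl | hx <;> rcases lt_trichotomy y 0 with hy | rfl | hy <;>
    simp [*, Real.sign_of_pos, Real.sign_of_neg, mul_pos_of_neg_of_neg, mul_neg_of_neg_of_pos,
      mul_neg_of_pos_of_neg]

theorem realSign_mul_mul_of_add_eq_zero {a b c : ℝ} (h : a + b + c = 0) :
    Real.sign a * Real.sign b * Real.sign c = -(Real.sign a + Real.sign b + Real.sign c) := by
  rcases lt_trichotomy a 0 with ha | ha | ha <;> rcases lt_trichotomy b 0 with hb | hb | hb <;>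
    rcases lt_trichotomy c 0 with hc | hc | hc <;>
    first
    | (exfalso; linarith)
    | simp [*, Real.sign_of_pos, Real.sign_of_neg]

theorem abs_realSign_le (x : ℝ) : |Real.sign x| ≤ 1 := by
  rcases Real.sign_apply_eq x with h | h | h <;> simp [h]

theorem measurable_realSign : Measurable Real.sign :=
  Measurable.ite measurableSet_Iio measurable_const
    (Measurable.ite measurableSet_Ioi measurable_const measurable_const)

theorem continuousAt_realSign {x : ℝ} (hx : x ≠ 0) : ContinuousAt Real.sign x := by
  rcases hx.lt_or_gt with h | h
  · refine continuousAt_const.congr (f := fun _ => -1) ?_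
    filter_upwards [eventually_lt_nhds h] with y hy using (Real.sign_of_neg hy).symm
  · refine continuousAt_const.congr (f := fun _ => 1) ?_
    filter_upwards [eventually_gt_nhds h] with y hy using (Real.sign_of_pos hy).symm

section SignKernel

variable {Ω : Type*}

/-- The kernel equal to `1` on concordant pairs, to `-1` on discordant pairs and to `0` on ties. -/
noncomputable def signKernel (X Y : Ω → ℝ) (a b : Ω) : ℝ :=
  Real.sign (X a - X b) * Real.sign (Y a - Y b)

theorem abs_signKernel_le (X Y : Ω → ℝ) (a b : Ω) : |signKernel X Y a b| ≤ 1 := by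
  rw [signKernel, abs_mul]
  exact mul_le_one₀ (abs_realSign_le _) (abs_nonneg _) (abs_realSign_le _)

variable [MeasurableSpace Ω]

/-- Kendall's tau, with ties counted as zero. -/
noncomputable def signTau (μ : Measure Ω) (X Y : Ω → ℝ) : ℝ :=
  ∫ w, signKernel X Y w.1 w.2 ∂μ.prod μ

/-- The centred rank of `X a` under the law of `X`: for continuous laws it is twice the
distribution function minus one. -/
noncomputable def signRank (μ : Measure Ω) (X : Ω → ℝ) (a : Ω) : ℝ :=
  ∫ b, Real.sign (X a - X b) ∂μ

/-- Spearman's rho in terms of centred ranks. -/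
noncomputable def signRho (μ : Measure Ω) (X Y : Ω → ℝ) : ℝ :=
  3 * ∫ a, signRank μ X a * signRank μ Y a ∂μ

theorem abs_signRank_le (μ : Measure Ω) [IsProbabilityMeasure μ] (X : Ω → ℝ) (a : Ω) :
    |signRank μ X a| ≤ 1 := by
  simpa [signRank] using norm_integral_le_of_norm_le_const
    (μ := μ) (f := fun b => Real.sign (X a - X b))
    (Filter.Eventually.of_forall fun b => abs_realSign_le _)

theorem abs_signTau_le (μ : Measure Ω) [IsProbabilityMeasure μ] (X Y : Ω → ℝ) :
    |signTau μ X Y| ≤ 1 := by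
  simpa [signTau] using norm_integral_le_of_norm_le_const
    (μ := μ.prod μ) (f := fun w => signKernel X Y w.1 w.2)
    (Filter.Eventually.of_forall fun w => abs_signKernel_le X Y _ _)

variable {X Y : Ω → ℝ}

theorem measurable_signKernel (hX : Measurable X) (hY : Measurable Y) :
    Measurable fun w : Ω × Ω => signKernel X Y w.1 w.2 := by
  unfold signKernel
  exact (measurable_realSign.comp (by fun_prop)).mul (measurable_realSign.comp (by fun_prop))

theorem measurable_signRank (μ : Measure Ω) [SFinite μ] (hX : Measurable X) :
    Measurable (signRank μ X) :=
  (StronglyMeasurable.integral_prod_right (f := fun a b => Real.sign (X a - X b))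
    (measurable_realSign.comp (by fun_prop)).stronglyMeasurable).measurable

theorem integral_realSign {μ : Measure Ω} [IsFiniteMeasure μ] (hX : Measurable X) :
    ∫ a, Real.sign (X a) ∂μ = μ.real {a | 0 < X a} - μ.real {a | X a < 0} := by
  have hpos : MeasurableSet {a | 0 < X a} := measurableSet_lt measurable_const hX
  have hneg : MeasurableSet {a | X a < 0} := measurableSet_lt hX measurable_const
  have hsign : (fun a => Real.sign (X a)) = fun a =>
      {a | 0 < X a}.indicator 1 a - {a | X a < 0}.indicator 1 a := by
    funext a
    rcases lt_trichotomy (X a) 0 with h | h | h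
    · simp [Real.sign_of_neg h, h, h.le]
    · simp [h]
    · simp [Real.sign_of_pos h, h, h.le]
  rw [hsign, integral_sub ((integrable_const 1).indicator hpos)
    ((integrable_const 1).indicator hneg), integral_indicator_one hpos,
    integral_indicator_one hneg]

end SignKernel

section FiniteSpace

variable {V : Type*} [Fintype V]

/-- The graph joining concordant points of a finite configuration in the plane; ties get edge
weight one half. -/
noncomputable def concGraph (x y : V → ℝ) (i j : V) : ℝ := (1 + signKernel x y i j) / 2

theorem signKernel_comm {V : Type*} (x y : V → ℝ) (i j : V) :
    signKernel x y i j = signKernel x y j i := by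
  rw [signKernel, signKernel, realSign_sub_comm (x j), realSign_sub_comm (y j), neg_mul_neg]

theorem isGraphon_concGraph {w : V → ℝ} (hw : ∀ i, 0 ≤ w i) (hsum : ∑ i, w i = 1)
    (x y : V → ℝ) : IsGraphon w (concGraph x y) where
  nonneg := hw
  sum_one := hsum
  symm i j := by rw [concGraph, concGraph, signKernel_comm]
  W_nonneg i j := by
    have := (abs_le.1 (abs_signKernel_le x y i j)).1
    rw [concGraph]
    linarith
  W_le_one i j := by
    have := (abs_le.1 (abs_signKernel_le x y i j)).2
    rw [concGraph]
    linarith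

theorem edgeDens_concGraph {w : V → ℝ} (hsum : ∑ i, w i = 1) (x y : V → ℝ) :
    edgeDens w (concGraph x y) = (1 + pairSum w (signKernel x y)) / 2 := by
  have hsplit : concGraph x y = fun i j => 1 / 2 + 1 / 2 * signKernel x y i j := by
    funext i j
    rw [concGraph]
    ring
  rw [edgeDens, hsplit, pairSum_add, pairSum_const hsum, pairSum_const_mul]
  ring

-- In the expansion of `maj3` the product of the three sign kernels is, by `hcyclic`, the
-- product of two sums of signs, whose mixed terms are the products of ranks.
theorem permSum_majKernel_concGraph {V : Type*} (x y : V → ℝ) (i j k : V) :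
    permSum (majKernel (concGraph x y)) i j k =
      permSum (fun i j k => 1 / 2 + 3 / 2 * (Real.sign (x i - x j) * Real.sign (y i - y k)))
        i j k := by
  have hcyclic (z : V → ℝ) := realSign_mul_mul_of_add_eq_zero
    (show (z i - z j) + (z j - z k) + (z k - z i) = 0 by ring)
  have hprod := congrArg₂ (· * ·) (hcyclic x) (hcyclic y)
  simp only [permSum, majKernel, maj3, concGraph, signKernel, realSign_sub_comm (x i) (x j),
    realSign_sub_comm (x j) (x k), realSign_sub_comm (x k) (x i), realSign_sub_comm (y i) (y j),
    realSign_sub_comm (y j) (y k), realSign_sub_comm (y k) (y i)] at hprod ⊢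
  linear_combination (-3 / 2) * hprod

theorem majDens_concGraph {w : V → ℝ} (hsum : ∑ i, w i = 1) (x y : V → ℝ) :
    majDens w (concGraph x y) = 1 / 2 + 3 / 2 * ∑ i, w i *
      ((∑ j, w j * Real.sign (x i - x j)) * ∑ k, w k * Real.sign (y i - y k)) := by
  rw [majDens, tripleSum_congr_of_permSum (permSum_majKernel_concGraph x y),
    tripleSum_eq_sum_pairSum, Finset.mul_sum]
  simp only [pairSum_add, pairSum_const hsum, pairSum_const_mul, pairSum_mul, mul_add,
    Finset.sum_add_distrib, ← Finset.sum_mul, hsum, one_mul, mul_left_comm (w _) (3 / 2 : ℝ)]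

theorem integral_prod_eq_pairSum [MeasurableSpace V] [MeasurableSingletonClass V] (μ : Measure V)
    [IsFiniteMeasure μ] (g : V → V → ℝ) :
    ∫ w, g w.1 w.2 ∂μ.prod μ = pairSum (fun i => μ.real {i}) g := by
  rw [integral_fintype .of_finite, Fintype.sum_prod_type, pairSum]
  simp only [← Set.singleton_prod_singleton, measureReal_prod_prod, smul_eq_mul]

end FiniteSpace

theorem cliqueBound_signTau_le_of_finite {V : Type*} [Finite V] [MeasurableSpace V]
    [MeasurableSingletonClass V] (μ : Measure V) [IsProbabilityMeasure μ] (x y : V → ℝ) :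
    cliqueBound ((1 + signTau μ x y) / 2) ≤ (1 + signRho μ x y) / 2 := by
  have := Fintype.ofFinite V
  have hsum : ∑ i, μ.real {i} = 1 := by simp
  have hbound := (isGraphon_concGraph (fun _ => measureReal_nonneg) hsum x y).cliqueBound_le
  rw [edgeDens_concGraph hsum, majDens_concGraph hsum, ← integral_prod_eq_pairSum] at hbound
  simp only [signTau, signRho, signRank, integral_fintype Integrable.of_finite, smul_eq_mul]
    at hbound ⊢
  linarith


section Approximation

variable {Ω : Type*} [MeasurableSpace Ω] {μ : Measure Ω} {X Y : Ω → ℝ}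

theorem signTau_map {V : Type*} [MeasurableSpace V] [SFinite μ] {κ : Ω → V} {x y : V → ℝ}
    (hκ : Measurable κ) (hx : Measurable x) (hy : Measurable y) :
    signTau (μ.map κ) x y = signTau μ (x ∘ κ) (y ∘ κ) := by
  rw [signTau, Measure.map_prod_map _ _ hκ hκ, integral_map (by fun_prop)
    (measurable_signKernel hx hy).aestronglyMeasurable]
  rfl

theorem signRho_map {V : Type*} [MeasurableSpace V] [SFinite μ] {κ : Ω → V} {x y : V → ℝ}
    (hκ : Measurable κ) (hx : Measurable x) (hy : Measurable y) :
    signRho (μ.map κ) x y = signRho μ (x ∘ κ) (y ∘ κ) := by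
  have hrank {z : V → ℝ} (hz : Measurable z) (v : V) :
      signRank (μ.map κ) z v = ∫ b, Real.sign (z v - z (κ b)) ∂μ :=
    integral_map hκ.aemeasurable
      (measurable_realSign.comp (measurable_const.sub hz)).aestronglyMeasurable
  have hmeas := (measurable_signRank (μ.map κ) hx).mul (measurable_signRank (μ.map κ) hy)
  refine congrArg (3 * ·) ((integral_map hκ.aemeasurable hmeas.aestronglyMeasurable).trans ?_)
  simp only [Pi.mul_apply, hrank hx, hrank hy]
  rfl

theorem cliqueBound_signTau_le_of_simpleFunc [IsProbabilityMeasure μ]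
    (f g : SimpleFunc Ω ℝ) :
    cliqueBound ((1 + signTau μ f g) / 2) ≤ (1 + signRho μ f g) / 2 := by
  let κ : Ω → f.range × g.range := fun a => (⟨f a, f.mem_range_self a⟩, ⟨g a, g.mem_range_self a⟩)
  have hκ : Measurable κ := f.measurable.subtype_mk.prodMk g.measurable.subtype_mk
  have := Measure.isProbabilityMeasure_map (μ := μ) hκ.aemeasurable
  have hbound := cliqueBound_signTau_le_of_finite (μ.map κ) (fun v => (v.1 : ℝ)) fun v => (v.2 : ℝ)
  rwa [signTau_map hκ (by fun_prop) (by fun_prop), signRho_map hκ (by fun_prop) (by fun_prop)]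
    at hbound

variable {f g : ℕ → Ω → ℝ}

theorem tendsto_realSign_sub {Ω : Type*} {X : Ω → ℝ} {f : ℕ → Ω → ℝ}
    (hf : ∀ a, Filter.Tendsto (f · a) Filter.atTop (nhds (X a)))
    {a b : Ω} (hab : X a ≠ X b) :
    Filter.Tendsto (fun n => Real.sign (f n a - f n b)) Filter.atTop
      (nhds (Real.sign (X a - X b))) :=
  (continuousAt_realSign (sub_ne_zero.2 hab)).tendsto.comp ((hf a).sub (hf b))

theorem tendsto_signTau [IsFiniteMeasure μ] (hfm : ∀ n, Measurable (f n))
    (hgm : ∀ n, Measurable (g n)) (hf : ∀ a, Filter.Tendsto (f · a) Filter.atTop (nhds (X a)))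
    (hg : ∀ a, Filter.Tendsto (g · a) Filter.atTop (nhds (Y a)))
    (hX : ∀ᵐ w ∂μ.prod μ, X w.1 ≠ X w.2) (hY : ∀ᵐ w ∂μ.prod μ, Y w.1 ≠ Y w.2) :
    Filter.Tendsto (fun n => signTau μ (f n) (g n)) Filter.atTop (nhds (signTau μ X Y)) := by
  refine tendsto_integral_of_dominated_convergence 1
    (fun n => (measurable_signKernel (hfm n) (hgm n)).aestronglyMeasurable) (integrable_const 1)
    (fun n => Filter.Eventually.of_forall fun w => abs_signKernel_le _ _ _ _) ?_
  filter_upwards [hX, hY] with w hXw hYw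
  exact (tendsto_realSign_sub hf hXw).mul (tendsto_realSign_sub hg hYw)

theorem tendsto_signRank [IsFiniteMeasure μ] (hfm : ∀ n, Measurable (f n))
    (hf : ∀ a, Filter.Tendsto (f · a) Filter.atTop (nhds (X a)))
    (hX : ∀ᵐ w ∂μ.prod μ, X w.1 ≠ X w.2) :
    ∀ᵐ a ∂μ, Filter.Tendsto (fun n => signRank μ (f n) a) Filter.atTop
      (nhds (signRank μ X a)) := by
  filter_upwards [Measure.ae_ae_of_ae_prod hX] with a ha
  refine tendsto_integral_of_dominated_convergence 1 (fun n => (measurable_realSign.comp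
    (measurable_const.sub (hfm n))).aestronglyMeasurable) (integrable_const 1)
    (fun n => Filter.Eventually.of_forall fun b => abs_realSign_le _) ?_
  filter_upwards [ha] with b hb using tendsto_realSign_sub hf hb

theorem tendsto_signRho [IsProbabilityMeasure μ] (hfm : ∀ n, Measurable (f n))
    (hgm : ∀ n, Measurable (g n)) (hf : ∀ a, Filter.Tendsto (f · a) Filter.atTop (nhds (X a)))
    (hg : ∀ a, Filter.Tendsto (g · a) Filter.atTop (nhds (Y a)))
    (hX : ∀ᵐ w ∂μ.prod μ, X w.1 ≠ X w.2) (hY : ∀ᵐ w ∂μ.prod μ, Y w.1 ≠ Y w.2) :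
    Filter.Tendsto (fun n => signRho μ (f n) (g n)) Filter.atTop (nhds (signRho μ X Y)) := by
  refine (tendsto_integral_of_dominated_convergence 1 (fun n => ((measurable_signRank μ (hfm n)).mul
    (measurable_signRank μ (hgm n))).aestronglyMeasurable) (integrable_const 1)
    (fun n => Filter.Eventually.of_forall fun a => ?_) ?_).const_mul 3
  · rw [Real.norm_eq_abs, Pi.mul_apply, abs_mul]
    exact mul_le_one₀ (abs_signRank_le _ _ _) (abs_nonneg _) (abs_signRank_le _ _ _)
  · filter_upwards [tendsto_signRank hfm hf hX, tendsto_signRank hgm hg hY] with a hXa hYa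
      using hXa.mul hYa

theorem cliqueBound_signTau_le [IsProbabilityMeasure μ] (hXm : Measurable X) (hYm : Measurable Y)
    (hX : ∀ᵐ w ∂μ.prod μ, X w.1 ≠ X w.2) (hY : ∀ᵐ w ∂μ.prod μ, Y w.1 ≠ Y w.2) :
    cliqueBound ((1 + signTau μ X Y) / 2) ≤ (1 + signRho μ X Y) / 2 := by
  have hf := hXm.stronglyMeasurable
  have hg := hYm.stronglyMeasurable
  have htau := tendsto_signTau (fun n => (hf.approx n).measurable)
    (fun n => (hg.approx n).measurable) hf.tendsto_approx hg.tendsto_approx hX hY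
  have hrho := tendsto_signRho (fun n => (hf.approx n).measurable)
    (fun n => (hg.approx n).measurable) hf.tendsto_approx hg.tendsto_approx hX hY
  have hmem (x y : Ω → ℝ) : (1 + signTau μ x y) / 2 ∈ Set.Icc (0 : ℝ) 1 := by
    have := abs_le.1 (abs_signTau_le μ x y)
    constructor <;> linarith
  refine le_of_tendsto_of_tendsto' ((continuousOn_cliqueBound _ (hmem X Y)).tendsto.comp
    (tendsto_nhdsWithin_iff.2 ⟨(htau.const_add 1).div_const 2,
      Filter.Eventually.of_forall fun n => hmem _ _⟩)) ((hrho.const_add 1).div_const 2) fun n =>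
    cliqueBound_signTau_le_of_simpleFunc (hf.approx n) (hg.approx n)

end Approximation

theorem integral_realSign_uniform {u : ℝ} (hu : u ∈ Set.Icc (0 : ℝ) 1) :
    ∫ t in Set.Icc (0 : ℝ) 1, Real.sign (u - t) = 2 * u - 1 := by
  have hle : {t | 0 < u - t} =ᵐ[volume.restrict (Set.Icc (0 : ℝ) 1)] Set.Iic u := by
    simp only [sub_pos]
    exact Iio_ae_eq_Iic
  have hgt : {t | u - t < 0} = (Set.Iic u)ᶜ := by
    ext t
    simp
  rw [integral_realSign (measurable_const_sub u), measureReal_congr hle, hgt,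
    probReal_compl_eq_one_sub measurableSet_Iic, measureReal_def, uniform_Iic hu,
    ENNReal.toReal_ofReal hu.1]
  ring

namespace IsDoublyStochastic

variable {μ : Measure (ℝ × ℝ)}

theorem signTau_eq (h : IsDoublyStochastic μ) :
    signTau μ Prod.fst Prod.snd = 2 * concordance μ - 1 := by
  have := h.isProbabilityMeasure
  have hsub := h.concordance_add_discordance zero_le_one
  have hint := integral_realSign (μ := μ.prod μ)
    (X := fun w => (w.1.1 - w.2.1) * (w.1.2 - w.2.2)) (by fun_prop)
  simp only [signTau, signKernel, ← realSign_mul]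
  rw [concordance, discordance] at *
  linarith

theorem signRank_fst (h : IsDoublyStochastic μ) {z : ℝ × ℝ} (hz : z.1 ∈ Set.Icc (0 : ℝ) 1) :
    signRank μ Prod.fst z = 2 * z.1 - 1 := by
  rw [← integral_realSign_uniform hz, ← h.fst]
  exact (integral_map measurable_fst.aemeasurable
    (measurable_realSign.comp (measurable_const_sub z.1)).aestronglyMeasurable).symm

theorem signRank_snd (h : IsDoublyStochastic μ) {z : ℝ × ℝ} (hz : z.2 ∈ Set.Icc (0 : ℝ) 1) :
    signRank μ Prod.snd z = 2 * z.2 - 1 := by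
  rw [← integral_realSign_uniform hz, ← h.snd]
  exact (integral_map measurable_snd.aemeasurable
    (measurable_realSign.comp (measurable_const_sub z.2)).aestronglyMeasurable).symm

theorem signRho_eq (h : IsDoublyStochastic μ) :
    signRho μ Prod.fst Prod.snd = 12 * (∫ z, z.1 * z.2 ∂μ) - 3 := by
  have := h.isProbabilityMeasure
  have hrank : (fun z => signRank μ Prod.fst z * signRank μ Prod.snd z) =ᵐ[μ]
      fun z => 4 * (z.1 * z.2) - (2 * z.1 + 2 * z.2 - 1) := by
    filter_upwards [h.ae_mem] with z hz
    rw [h.signRank_fst hz.1, h.signRank_snd hz.2]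
    ring
  rw [signRho, integral_congr_ae hrank, integral_sub, integral_sub, integral_add,
    integral_const_mul, integral_const_mul, integral_const_mul, h.integral_fst zero_le_one,
    h.integral_snd zero_le_one]
  · simp
    ring
  all_goals exact h.integrable_of_continuous (by fun_prop)

theorem cliqueBound_le (h : IsDoublyStochastic μ) :
    cliqueBound (concordance μ) ≤ 6 * (∫ z, z.1 * z.2 ∂μ) - 1 := by
  have := h.isProbabilityMeasure
  have hbound := cliqueBound_signTau_le measurable_fst measurable_snd
    (h.ae_ne.mono fun _ hw => hw.1) (h.ae_ne.mono fun _ hw => hw.2)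
  rw [h.signTau_eq, h.signRho_eq, add_sub_cancel, mul_div_cancel_left₀ _ two_ne_zero] at hbound
  linarith

end IsDoublyStochastic

/-! ### Skew sums and attainable values -/

section IntervalMeasures

theorem map_add_const_restrict_Icc (c t : ℝ) :
    (volume.restrict (Set.Icc 0 t)).map (· + c) = volume.restrict (Set.Icc c (c + t)) := by
  have h := (measurePreserving_add_right volume c).restrict_preimage
    (measurableSet_Icc (a := c) (b := c + t))
  rw [Set.preimage_add_const_Icc, sub_self, add_sub_cancel_left] at h
  exact h.map_eq

theorem map_const_sub_restrict_Icc (t : ℝ) :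
    (volume.restrict (Set.Icc 0 t)).map (t - ·) = volume.restrict (Set.Icc 0 t) := by
  have h := (Measure.measurePreserving_sub_left volume t).restrict_preimage
    (measurableSet_Icc (a := 0) (b := t))
  rw [Set.preimage_const_sub_Icc, sub_self, sub_zero] at h
  exact h.map_eq

theorem restrict_Icc_add_restrict_Icc {a b c : ℝ} (hab : a ≤ b) (hbc : b ≤ c) :
    volume.restrict (Set.Icc a b) + volume.restrict (Set.Icc b c) =
      volume.restrict (Set.Icc a c) := by
  rw [← restrict_Ioc_eq_restrict_Icc (a := b), ← Set.Icc_union_Ioc_eq_Icc hab hbc,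
    Measure.restrict_union _ measurableSet_Ioc]
  exact Set.disjoint_left.2 fun _ hx hx' => hx'.1.not_ge hx.2

end IntervalMeasures

/-- The skew sum of two measures on the squares `[0, s]²` and `[0, t]²`: the first one is placed in
the upper left corner, and the second one in the lower right corner, of `[0, s + t]²`. -/
noncomputable def skewSum (s t : ℝ) (μ ν : Measure (ℝ × ℝ)) : Measure (ℝ × ℝ) :=
  μ.map (· + (0, t)) + ν.map (· + (s, 0))

theorem concordance_map_add_const (μ : Measure (ℝ × ℝ)) [SFinite μ] (c : ℝ × ℝ) :
    concordance (μ.map (· + c)) = concordance μ := by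
  have hc : Measurable (· + c) := measurable_add_const c
  rw [concordance, Measure.map_prod_map _ _ hc hc,
    map_measureReal_apply (hc.prodMap hc) measurableSet_concordant]
  simp only [Set.preimage_ofPred_eq, Prod.map_fst, Prod.map_snd, Prod.fst_add, Prod.snd_add,
    add_sub_add_right_eq_sub]
  rfl

theorem concordance_add {μ ν : Measure (ℝ × ℝ)} [IsFiniteMeasure μ] [IsFiniteMeasure ν]
    (h : ∀ᵐ w ∂μ.prod ν, (w.1.1 - w.2.1) * (w.1.2 - w.2.2) ≤ 0) :
    concordance (μ + ν) = concordance μ + concordance ν := by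
  have h' : ∀ᵐ w ∂ν.prod μ, (w.1.1 - w.2.1) * (w.1.2 - w.2.2) ≤ 0 := by
    filter_upwards [Measure.measurePreserving_swap.quasiMeasurePreserving.ae h] with w hw
    rwa [← neg_mul_neg, neg_sub, neg_sub]
  have hnull : (μ.prod ν).real {w | 0 < (w.1.1 - w.2.1) * (w.1.2 - w.2.2)} = 0 := by
    rw [measureReal_eq_zero_iff]
    exact measure_eq_zero_iff_ae_notMem.2 (h.mono fun _ hw => hw.not_gt)
  have hnull' : (ν.prod μ).real {w | 0 < (w.1.1 - w.2.1) * (w.1.2 - w.2.2)} = 0 := by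
    rw [measureReal_eq_zero_iff]
    exact measure_eq_zero_iff_ae_notMem.2 (h'.mono fun _ hw => hw.not_gt)
  rw [concordance, Measure.prod_add, Measure.add_prod, Measure.add_prod, measureReal_add_apply,
    measureReal_add_apply, measureReal_add_apply, hnull, hnull', add_zero, zero_add]
  rfl

namespace HasUniformMarginals

variable {s t : ℝ} {μ ν : Measure (ℝ × ℝ)}

theorem skewSum (hμ : HasUniformMarginals s μ) (hν : HasUniformMarginals t ν) (hs : 0 ≤ s)
    (ht : 0 ≤ t) : HasUniformMarginals (s + t) (skewSum s t μ ν) where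
  fst := by
    have hμ' : (μ.map (· + (0, t))).map Prod.fst = volume.restrict (Set.Icc 0 s) := by
      rw [Measure.map_map measurable_fst (measurable_add_const _), ← hμ.fst]
      simp only [Function.comp_def, Prod.fst_add, add_zero]
    have hν' : (ν.map (· + (s, 0))).map Prod.fst = volume.restrict (Set.Icc s (s + t)) := by
      rw [Measure.map_map measurable_fst (measurable_add_const _), ← map_add_const_restrict_Icc,
        ← hν.fst, Measure.map_map (measurable_add_const s) measurable_fst]
      rfl
    rw [_root_.skewSum, Measure.map_add _ _ measurable_fst, hμ', hν',
      restrict_Icc_add_restrict_Icc hs (by linarith)]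
  snd := by
    have hν' : (ν.map (· + (s, 0))).map Prod.snd = volume.restrict (Set.Icc 0 t) := by
      rw [Measure.map_map measurable_snd (measurable_add_const _), ← hν.snd]
      simp only [Function.comp_def, Prod.snd_add, add_zero]
    have hμ' : (μ.map (· + (0, t))).map Prod.snd = volume.restrict (Set.Icc t (t + s)) := by
      rw [Measure.map_map measurable_snd (measurable_add_const _), ← map_add_const_restrict_Icc,
        ← hμ.snd, Measure.map_map (measurable_add_const t) measurable_snd]
      rfl
    rw [_root_.skewSum, Measure.map_add _ _ measurable_snd, hν', hμ', add_comm,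
      restrict_Icc_add_restrict_Icc ht (by linarith), add_comm s]

theorem concordance_skewSum (hμ : HasUniformMarginals s μ) (hν : HasUniformMarginals t ν) :
    concordance (_root_.skewSum s t μ ν) = concordance μ + concordance ν := by
  have := hμ.isFiniteMeasure
  have := hν.isFiniteMeasure
  rw [_root_.skewSum, concordance_add, concordance_map_add_const, concordance_map_add_const]
  have hμ' : Measurable (· + ((0, t) : ℝ × ℝ)) := measurable_add_const _
  have hν' : Measurable (· + ((s, 0) : ℝ × ℝ)) := measurable_add_const _
  rw [Measure.map_prod_map _ _ hμ' hν', ae_map_iff (hμ'.prodMap hν').aemeasurable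
    (measurableSet_le (by fun_prop) measurable_const)]
  filter_upwards [Measure.quasiMeasurePreserving_fst.ae hμ.ae_mem,
    Measure.quasiMeasurePreserving_snd.ae hν.ae_mem] with w hw hw'
  refine mul_nonpos_of_nonpos_of_nonneg ?_ ?_
  · simpa using hw.1.2.trans (by linarith [hw'.1.1])
  · simpa using hw'.2.2.trans (by linarith [hw.2.1])

theorem integral_mul_skewSum (hμ : HasUniformMarginals s μ) (hν : HasUniformMarginals t ν)
    (hs : 0 ≤ s) (ht : 0 ≤ t) : ∫ z, z.1 * z.2 ∂(_root_.skewSum s t μ ν) =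
      ((∫ z, z.1 * z.2 ∂μ) + t * (s ^ 2 / 2)) + ((∫ z, z.1 * z.2 ∂ν) + s * (t ^ 2 / 2)) := by
  have hint := hμ.skewSum hν hs ht |>.integrable_of_continuous
    (f := fun z => z.1 * z.2) (by fun_prop)
  have hμ' : ∫ z, z.1 * z.2 ∂(μ.map (· + (0, t))) = (∫ z, z.1 * z.2 ∂μ) + t * (s ^ 2 / 2) := by
    rw [integral_map (measurable_add_const _).aemeasurable (by fun_prop), ← hμ.integral_fst hs,
      ← integral_const_mul, ← integral_add]
    · simp only [Prod.fst_add, Prod.snd_add, add_zero, mul_add, mul_comm]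
    all_goals exact hμ.integrable_of_continuous (by fun_prop)
  have hν' : ∫ z, z.1 * z.2 ∂(ν.map (· + (s, 0))) = (∫ z, z.1 * z.2 ∂ν) + s * (t ^ 2 / 2) := by
    rw [integral_map (measurable_add_const _).aemeasurable (by fun_prop), ← hν.integral_snd ht,
      ← integral_const_mul, ← integral_add]
    · simp only [Prod.fst_add, Prod.snd_add, add_zero, add_mul]
    all_goals exact hν.integrable_of_continuous (by fun_prop)
  rw [_root_.skewSum, integral_add_measure hint.left_of_add_measure hint.right_of_add_measure,
    hμ', hν']

end HasUniformMarginals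

section Reflection

variable {s : ℝ} {μ : Measure (ℝ × ℝ)}

theorem HasUniformMarginals.reflect (h : HasUniformMarginals s μ) :
    HasUniformMarginals s (μ.map fun z => (z.1, s - z.2)) where
  fst := by
    rw [Measure.map_map measurable_fst (by fun_prop)]
    exact h.fst
  snd := by
    rw [Measure.map_map measurable_snd (by fun_prop), ← map_const_sub_restrict_Icc, ← h.snd,
      Measure.map_map (by fun_prop) measurable_snd]
    rfl

theorem concordance_reflect (μ : Measure (ℝ × ℝ)) [SFinite μ] (s : ℝ) :
    concordance (μ.map fun z => (z.1, s - z.2)) = discordance μ := by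
  have hmeas : Measurable fun z : ℝ × ℝ => (z.1, s - z.2) := by fun_prop
  rw [concordance, Measure.map_prod_map _ _ hmeas hmeas,
    map_measureReal_apply (hmeas.prodMap hmeas) measurableSet_concordant, discordance]
  congr 1
  ext w
  simp only [Set.mem_preimage, Set.mem_ofPred, Prod.map_fst, Prod.map_snd,
    mul_pos_iff, mul_neg_iff, sub_pos, sub_neg, sub_lt_sub_iff_left]

theorem HasUniformMarginals.integral_mul_reflect (h : HasUniformMarginals s μ) (hs : 0 ≤ s) :
    ∫ z, z.1 * z.2 ∂(μ.map fun z => (z.1, s - z.2)) =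
      s * (s ^ 2 / 2) - ∫ z, z.1 * z.2 ∂μ := by
  have hmeas : Measurable fun z : ℝ × ℝ => (z.1, s - z.2) := by fun_prop
  rw [integral_map hmeas.aemeasurable (by fun_prop), ← h.integral_fst hs, ← integral_const_mul,
    ← integral_sub]
  · simp only [mul_sub, mul_comm]
  all_goals exact h.integrable_of_continuous (by fun_prop)

end Reflection

/-- `(d, F)` are the concordance and the normalised mixed moment `6 ∫ x y - s³` of some measure
with uniform marginals of mass `s`. For the doubly stochastic case `s = 1` these are
`(1 + τ) / 2` and `(1 + ρ) / 2`; the normalisation makes both quantities additive under skew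
sums. -/
def Attainable (s d F : ℝ) : Prop :=
  0 ≤ s ∧ ∃ μ : Measure (ℝ × ℝ), HasUniformMarginals s μ ∧ concordance μ = d ∧
    6 * (∫ z, z.1 * z.2 ∂μ) - s ^ 3 = F

namespace Attainable

variable {s t d d' F F' u : ℝ}

theorem add (h : Attainable s d F) (h' : Attainable t d' F') :
    Attainable (s + t) (d + d') (F + F') := by
  obtain ⟨hs, μ, hμ, rfl, rfl⟩ := h
  obtain ⟨ht, ν, hν, rfl, rfl⟩ := h'
  refine ⟨add_nonneg hs ht, _, hμ.skewSum hν hs ht, hμ.concordance_skewSum hν, ?_⟩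
  rw [hμ.integral_mul_skewSum hν hs ht]
  ring

theorem compl (h : Attainable s d F) : Attainable s (s ^ 2 - d) (s ^ 3 - F) := by
  obtain ⟨hs, μ, hμ, rfl, rfl⟩ := h
  have := hμ.isFiniteMeasure
  refine ⟨hs, _, hμ.reflect, ?_, ?_⟩
  · rw [concordance_reflect, ← hμ.concordance_add_discordance hs, add_sub_cancel_left]
  · rw [hμ.integral_mul_reflect hs]
    ring

theorem clique (hu : 0 ≤ u) : Attainable u (u ^ 2) (u ^ 3) := by
  have hmeas : Measurable fun x : ℝ => (x, x) := by fun_prop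
  have hμ : HasUniformMarginals u ((volume.restrict (Set.Icc 0 u)).map fun x => (x, x)) :=
    ⟨by rw [Measure.map_map measurable_fst hmeas]; exact Measure.map_id,
      by rw [Measure.map_map measurable_snd hmeas]; exact Measure.map_id⟩
  have hdisc : discordance ((volume.restrict (Set.Icc 0 u)).map fun x => (x, x)) = 0 := by
    rw [discordance, Measure.map_prod_map _ _ hmeas hmeas,
      map_measureReal_apply (hmeas.prodMap hmeas) measurableSet_discordant]
    simp only [Set.preimage_ofPred_eq, Prod.map_fst, Prod.map_snd,
      (mul_self_nonneg _).not_gt, Set.ofPred_false, measureReal_empty]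
  refine ⟨hu, _, hμ, by rw [← hμ.concordance_add_discordance hu, hdisc, add_zero], ?_⟩
  rw [integral_map hmeas.aemeasurable (by fun_prop), integral_Icc_eq_integral_Ioc,
    ← intervalIntegral.integral_of_le hu]
  simp only [← sq, integral_pow]
  norm_num
  ring

theorem zero (hs : 0 ≤ s) : Attainable s 0 0 := by
  simpa using (clique hs).compl

theorem mono (h : Attainable s d F) (hst : s ≤ t) : Attainable t d F := by
  simpa using h.add (zero (sub_nonneg.2 hst))

theorem cliques (k : ℕ) (hu : 0 ≤ u) : Attainable (k * u) (k * u ^ 2) (k * u ^ 3) := by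
  induction k with
  | zero => simpa using zero le_rfl
  | succ k ih => simpa only [Nat.cast_succ, add_one_mul] using ih.add (clique hu)

end Attainable

theorem sqrt_add_sqrt_mul_le_add {a c S t : ℝ} (ha : 0 ≤ a) (hc : 0 ≤ c) (hS : S ≤ a * c)
    (ht : t ∈ Set.Icc (0 : ℝ) 1) : √(a ^ 2 + t * S) + √(1 - t) * c ≤ a + c := by
  have hgrown : √(a ^ 2 + t * S) ≤ a + t * c / 2 := by
    have := mul_nonneg ht.1 hc
    refine Real.sqrt_le_iff.2 ⟨by positivity, ?_⟩
    nlinarith [mul_le_mul_of_nonneg_left hS ht.1, sq_nonneg (t * c)]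
  have hshrunk : √(1 - t) ≤ 1 - t / 2 :=
    Real.sqrt_le_iff.2 ⟨by linarith [ht.2], by nlinarith [sq_nonneg t]⟩
  linarith [mul_le_mul_of_nonneg_right hshrunk hc]

namespace Attainable

variable {d F : ℝ}

/-- Transferring concordance from all other cliques to the first one, at constant total
concordance, interpolates between the extremal profile and a single clique. -/
theorem transfer {k : ℕ} {a b t : ℝ} (h : IsCliqueProfile (k + 1) a b)
    (ht : t ∈ Set.Icc (0 : ℝ) 1) :
    Attainable 1 ((k + 1) * a ^ 2 + b ^ 2)
      (√(a ^ 2 + t * (k * a ^ 2 + b ^ 2)) ^ 3 + √(1 - t) ^ 3 * (k * a ^ 3 + b ^ 3)) := by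
  have ha := h.pos.le
  have hb := h.nonneg
  have hsq : √(1 - t) ^ 2 = 1 - t := Real.sq_sqrt (sub_nonneg.2 ht.2)
  have hsq' : √(a ^ 2 + t * (k * a ^ 2 + b ^ 2)) ^ 2 = a ^ 2 + t * (k * a ^ 2 + b ^ 2) :=
    Real.sq_sqrt (add_nonneg (sq_nonneg a) (mul_nonneg ht.1 (by positivity)))
  have hcliques := (clique (Real.sqrt_nonneg (a ^ 2 + t * (k * a ^ 2 + b ^ 2)))).add
    ((cliques k (mul_nonneg (Real.sqrt_nonneg (1 - t)) ha)).add
      (clique (mul_nonneg (Real.sqrt_nonneg (1 - t)) hb)))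
  have hmass := sqrt_add_sqrt_mul_le_add (S := k * a ^ 2 + b ^ 2) (c := k * a + b) ha
    (by positivity) (by nlinarith [mul_le_mul_of_nonneg_left h.le hb]) ht
  have htotal : a + (k * a + b) = 1 := by
    rw [← h.mass]; push_cast; ring
  convert hcliques.mono (t := 1) (by linarith) using 1
  · rw [hsq', mul_pow, mul_pow, hsq]; ring
  · ring

theorem of_le_sqrt_pow (hd : 0 < d) (hd' : d ≤ 1) (hF : cliqueBound d ≤ F) (hF' : F ≤ √d ^ 3) :
    Attainable 1 d F := by
  obtain ⟨n, a, b, h, rfl⟩ := exists_isCliqueProfile hd hd'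
  obtain ⟨k, rfl⟩ := Nat.exists_eq_add_of_le' h.one_le
  rw [h.cliqueBound_density] at hF
  push_cast at hF hF' ⊢
  let f : ℝ → ℝ := fun t =>
    √(a ^ 2 + t * (k * a ^ 2 + b ^ 2)) ^ 3 + √(1 - t) ^ 3 * (k * a ^ 3 + b ^ 3)
  have hf : ContinuousOn f (Set.Icc 0 1) := by
    unfold f; fun_prop
  have hf0 : f 0 = (k + 1) * a ^ 3 + b ^ 3 := by
    simp only [f, zero_mul, add_zero, sub_zero, Real.sqrt_one, Real.sqrt_sq h.pos.le]
    ring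
  have hf1 : f 1 = √((k + 1) * a ^ 2 + b ^ 2) ^ 3 := by
    simp only [f, sub_self, Real.sqrt_zero, one_mul]
    ring_nf
  obtain ⟨t, ht, rfl⟩ := intermediate_value_Icc zero_le_one hf
    (show F ∈ Set.Icc (f 0) (f 1) from ⟨hf0 ▸ hF, hf1 ▸ hF'⟩)
  exact transfer h ht

theorem of_sqrt_pow_le (hd : 0 ≤ d) (hd' : d ≤ 1) (hF : √d ^ 3 ≤ F)
    (hF' : F ≤ 1 - √(1 - d) ^ 3) : Attainable 1 d F := by
  have hsq : √d ^ 2 = d := Real.sq_sqrt hd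
  let f : ℝ → ℝ := fun m => m ^ 3 - √(m ^ 2 - d) ^ 3
  have hf : ContinuousOn f (Set.Icc (√d) 1) := by
    unfold f; fun_prop
  obtain ⟨m, hm, rfl⟩ := intermediate_value_Icc (Real.sqrt_le_one.2 hd') hf
    (show F ∈ Set.Icc (f √d) (f 1) from ⟨by simpa [f, hsq] using hF, by simpa [f] using hF'⟩)
  have hm0 : 0 ≤ m := (Real.sqrt_nonneg d).trans hm.1
  have hdm : d ≤ m ^ 2 := (Real.sqrt_le_left hm0).1 hm.1
  have hle : √(m ^ 2 - d) ≤ m := Real.sqrt_le_iff.2 ⟨hm0, sub_le_self _ hd⟩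
  have h := (((clique (Real.sqrt_nonneg (m ^ 2 - d))).mono hle).compl).mono hm.2
  rwa [Real.sq_sqrt (sub_nonneg.2 hdm), sub_sub_cancel] at h

end Attainable

theorem attainable_of_bounds {d F : ℝ} (hd : 0 ≤ d) (hd' : d ≤ 1) (hF : cliqueBound d ≤ F)
    (hF' : F ≤ 1 - cliqueBound (1 - d)) : Attainable 1 d F := by
  rcases hd.eq_or_lt with rfl | hd
  · rw [cliqueBound_zero] at hF
    rw [sub_zero, cliqueBound_one, sub_self] at hF'
    exact hF'.antisymm hF ▸ Attainable.zero zero_le_one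
  rcases hd'.eq_or_lt with rfl | hd'
  · rw [cliqueBound_one] at hF
    rw [sub_self, cliqueBound_zero, sub_zero] at hF'
    simpa [hF'.antisymm hF] using Attainable.clique zero_le_one
  rcases le_total F (√d ^ 3) with hlow | hlow
  · exact .of_le_sqrt_pow hd hd'.le hF hlow
  rcases le_total F (1 - √(1 - d) ^ 3) with hmid | hhigh
  · exact .of_sqrt_pow_le hd.le hd'.le hlow hmid
  · simpa using (Attainable.of_le_sqrt_pow (d := 1 - d) (F := 1 - F) (by linarith) (by linarith)
      (by linarith) (by linarith)).compl

theorem attainable_iff {d F : ℝ} : Attainable 1 d F ↔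
    0 ≤ d ∧ d ≤ 1 ∧ cliqueBound d ≤ F ∧ F ≤ 1 - cliqueBound (1 - d) := by
  refine ⟨fun h => ?_, fun ⟨hd, hd', hF, hF'⟩ => attainable_of_bounds hd hd' hF hF'⟩
  have hlower {d F : ℝ} (h : Attainable 1 d F) : 0 ≤ d ∧ cliqueBound d ≤ F := by
    obtain ⟨-, μ, hμ, rfl, rfl⟩ := h
    rw [one_pow]
    exact ⟨measureReal_nonneg, IsDoublyStochastic.cliqueBound_le hμ⟩
  have hcompl := hlower h.compl
  rw [one_pow, one_pow] at hcompl
  exact ⟨(hlower h).1, by linarith [hcompl.1], (hlower h).2, by linarith [hcompl.2]⟩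

/-! ### The exact region -/

theorem mem_exactRegion_iff_attainable {p : ℝ × ℝ} :
    p ∈ exactRegion ↔ Attainable 1 ((1 + p.1) / 2) ((1 + p.2) / 2) := by
  rw [exactRegion_eq_dsRegion]
  constructor
  · rintro ⟨μ, hμ, rfl⟩
    exact ⟨zero_le_one, μ, hμ, by ring, by ring⟩
  · rintro ⟨-, μ, hμ, hd, hF⟩
    exact ⟨μ, hμ, Prod.ext (by linarith [hd]) (by linarith [hF])⟩

theorem mem_exactRegion {p : ℝ × ℝ} : p ∈ exactRegion ↔
    p.1 ∈ Set.Icc (-1 : ℝ) 1 ∧ Phi p.1 ≤ p.2 ∧ p.2 ≤ -Phi (-p.1) := by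
  rw [mem_exactRegion_iff_attainable, attainable_iff, cliqueBound_half,
    show 1 - (1 + p.1) / 2 = (1 + -p.1) / 2 by ring, cliqueBound_half, Set.mem_Icc]
  constructor
  · rintro ⟨h0, h1, hlow, hupp⟩
    refine ⟨⟨?_, ?_⟩, ?_, ?_⟩ <;> linarith
  · rintro ⟨⟨h0, h1⟩, hlow, hupp⟩
    refine ⟨?_, ?_, ?_, ?_⟩ <;> linarith

theorem half_one_add_mem_Icc {x : ℝ} (hx : x ∈ Set.Icc (-1 : ℝ) 1) :
    (1 + x) / 2 ∈ Set.Icc (0 : ℝ) 1 :=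
  ⟨by linarith [hx.1], by linarith [hx.2]⟩

theorem neg_mem_Icc_neg_one_one {x : ℝ} (hx : x ∈ Set.Icc (-1 : ℝ) 1) : -x ∈ Set.Icc (-1 : ℝ) 1 :=
  ⟨neg_le_neg hx.2, neg_le.1 hx.1⟩

theorem parabola_le_Phi {x : ℝ} (hx : x ∈ Set.Icc (-1 : ℝ) 1) : (1 + x) ^ 2 / 2 - 1 ≤ Phi x := by
  have hd := half_one_add_mem_Icc hx
  linarith [sq_le_cliqueBound hd.1 hd.2, cliqueBound_half x]

theorem Phi_le_self {x : ℝ} (hx : x ∈ Set.Icc (-1 : ℝ) 1) : Phi x ≤ x := by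
  have hd := half_one_add_mem_Icc hx
  linarith [cliqueBound_le_self hd.1 hd.2, cliqueBound_half x]

theorem durbin_stuart {p : ℝ × ℝ} (hp : p ∈ exactRegion) :
    (1 + p.1) ^ 2 / 2 - 1 ≤ p.2 ∧ p.2 ≤ 1 - (1 - p.1) ^ 2 / 2 := by
  obtain ⟨hx, hlow, hupp⟩ := mem_exactRegion.1 hp
  have hneg := parabola_le_Phi (neg_mem_Icc_neg_one_one hx)
  rw [← sub_eq_add_neg] at hneg
  exact ⟨(parabola_le_Phi hx).trans hlow, by linarith⟩

theorem exactRegion_eq_regionPhi : exactRegion = regionPhi := by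
  ext p
  refine ⟨fun hp => ?_, fun ⟨hx, _, h⟩ => mem_exactRegion.2 ⟨hx, h⟩⟩
  obtain ⟨hx, h⟩ := mem_exactRegion.1 hp
  obtain ⟨hlow, hupp⟩ := durbin_stuart hp
  refine ⟨hx, ⟨?_, ?_⟩, h⟩
  · linarith [sq_nonneg (1 + p.1)]
  · linarith [sq_nonneg (1 - p.1)]

theorem neg_mem_exactRegion {p : ℝ × ℝ} (hp : p ∈ exactRegion) : -p ∈ exactRegion := by
  rw [mem_exactRegion_iff_attainable] at hp ⊢
  convert hp.compl using 1 <;> simp only [Prod.fst_neg, Prod.snd_neg] <;> ring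

theorem neg_mem_exactRegion_iff {p : ℝ × ℝ} : -p ∈ exactRegion ↔ p ∈ exactRegion :=
  ⟨fun hp => neg_neg p ▸ neg_mem_exactRegion hp, neg_mem_exactRegion⟩

theorem diag_mem_exactRegion {x : ℝ} (hx : x ∈ Set.Icc (-1 : ℝ) 1) : (x, x) ∈ exactRegion :=
  mem_exactRegion.2 ⟨hx, Phi_le_self hx, le_neg.2 (Phi_le_self (neg_mem_Icc_neg_one_one hx))⟩

theorem dsPoint_mem_exactRegion {n : ℕ} (hn : 1 ≤ n) : dsPoint n ∈ exactRegion := by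
  have hn' : (1 : ℝ) ≤ n := by exact_mod_cast hn
  have hpos : (0 : ℝ) < 1 / n := by positivity
  have hle : (1 : ℝ) / n ≤ 1 := (div_le_one (by positivity)).2 hn'
  have hfst : (1 + (dsPoint n).1) / 2 = 1 / n := by simp only [dsPoint]; ring
  have hsnd : (1 + (dsPoint n).2) / 2 = (1 / n) ^ 2 := by simp only [dsPoint]; ring
  rw [mem_exactRegion_iff_attainable, attainable_iff, hfst, hsnd]
  refine ⟨hpos.le, hle, ((cliqueBound_eq_sq_iff hpos hle).2 ⟨n, hn, rfl⟩).le, ?_⟩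
  calc (1 / n : ℝ) ^ 2 ≤ 1 / n := pow_le_of_le_one hpos.le hle two_ne_zero
    _ ≤ 1 - cliqueBound (1 - 1 / n) := by
      linarith [cliqueBound_le_self (sub_nonneg.2 hle) (sub_le_self 1 hpos.le)]

theorem eq_or_eq_dsPoint_of_durbin_stuart_eq {p : ℝ × ℝ} (hp : p ∈ exactRegion)
    (heq : p.2 = (1 + p.1) ^ 2 / 2 - 1) : p = (-1, -1) ∨ ∃ n : ℕ, 1 ≤ n ∧ p = dsPoint n := by
  obtain ⟨hd, hd', hlow, -⟩ := attainable_iff.1 (mem_exactRegion_iff_attainable.1 hp)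
  rcases hd.eq_or_lt with hd | hd
  · have hfst : p.1 = -1 := by linarith
    exact Or.inl (Prod.ext hfst (by rw [heq, hfst]; norm_num))
  · rw [show (1 + p.2) / 2 = ((1 + p.1) / 2) ^ 2 by rw [heq]; ring] at hlow
    obtain ⟨k, hk, hdk⟩ :=
      (cliqueBound_eq_sq_iff hd hd').1 (hlow.antisymm (sq_le_cliqueBound hd.le hd'))
    have hfst : p.1 = -1 + 2 / k := by linear_combination 2 * hdk
    refine Or.inr ⟨k, hk, Prod.ext hfst ?_⟩
    rw [heq, hfst, dsPoint]
    ring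

theorem durbin_stuart_eq_iff {p : ℝ × ℝ} :
    (p ∈ exactRegion ∧ p.2 = (1 + p.1) ^ 2 / 2 - 1) ↔
      (p = (-1, -1) ∨ ∃ n : ℕ, 1 ≤ n ∧ p = dsPoint n) := by
  refine ⟨fun ⟨hp, heq⟩ => eq_or_eq_dsPoint_of_durbin_stuart_eq hp heq, ?_⟩
  rintro (rfl | ⟨n, hn, rfl⟩)
  · exact ⟨diag_mem_exactRegion (by norm_num), by norm_num⟩
  · exact ⟨dsPoint_mem_exactRegion hn, by simp only [dsPoint]; ring⟩

theorem durbin_stuart_upper_eq_iff {p : ℝ × ℝ} :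
    (p ∈ exactRegion ∧ p.2 = 1 - (1 - p.1) ^ 2 / 2) ↔
      (p = (1, 1) ∨ ∃ n : ℕ, 1 ≤ n ∧ p = -dsPoint n) := by
  have hparabola : (-p).2 = (1 + (-p).1) ^ 2 / 2 - 1 ↔ p.2 = 1 - (1 - p.1) ^ 2 / 2 := by
    rw [Prod.fst_neg, Prod.snd_neg, neg_eq_iff_eq_neg, neg_sub, ← sub_eq_add_neg]
  have hcorner : -p = (-1, -1) ↔ p = (1, 1) := neg_inj (b := ((1, 1) : ℝ × ℝ))
  simpa only [neg_mem_exactRegion_iff, hparabola, hcorner, neg_eq_iff_eq_neg] using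
    durbin_stuart_eq_iff (p := -p)

theorem cliqueBound_five_twelfths : cliqueBound (5 / 12) = (28 - √2) / 144 := by
  have hsq : √2 ^ 2 = (2 : ℝ) := Real.sq_sqrt two_pos.le
  have hle : √2 ≤ (2 : ℝ) := Real.sqrt_le_iff.2 (by norm_num)
  have h : IsCliqueProfile 2 ((4 + √2) / 12) ((4 - 2 * √2) / 12) :=
    ⟨one_le_two, by linarith, by linarith [Real.sqrt_nonneg 2], by push_cast; ring⟩
  convert h.cliqueBound_density using 2
  · push_cast
    linear_combination (-1 / 24) * hsq
  · push_cast
    linear_combination (√2 / 288 - 1 / 24) * hsq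

theorem not_convex_exactRegion : ¬ Convex ℝ exactRegion := by
  intro hconvex
  have hmid := hconvex (dsPoint_mem_exactRegion one_le_two)
    (dsPoint_mem_exactRegion (n := 3) (by norm_num)) (a := 1 / 2) (b := 1 / 2) (by norm_num)
    (by norm_num) (by norm_num)
  have hlow := (attainable_iff.1 (mem_exactRegion_iff_attainable.1 hmid)).2.2.1
  norm_num [dsPoint, cliqueBound_five_twelfths] at hlow
  have : √2 < (2 : ℝ) := (Real.sqrt_lt' two_pos).2 (by norm_num)
  linarith

theorem continuousOn_Phi : ContinuousOn Phi (Set.Icc (-1) 1) := by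
  have hcomp : ContinuousOn (fun x : ℝ => 2 * cliqueBound ((1 + x) / 2) - 1) (Set.Icc (-1) 1) :=
    (continuousOn_const.mul (continuousOn_cliqueBound.comp (by fun_prop)
      fun _ => half_one_add_mem_Icc)).sub continuousOn_const
  exact hcomp.congr fun x _ => by linarith [cliqueBound_half x]

theorem isCompact_exactRegion : IsCompact exactRegion := by
  let square : Set (ℝ × ℝ) := Set.Icc (-1) 1 ×ˢ Set.Icc (-1) 1
  have hsquare : IsCompact square := isCompact_Icc.prod isCompact_Icc
  have hPhi : ContinuousOn (fun p : ℝ × ℝ => Phi p.1) square :=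
    continuousOn_Phi.comp continuousOn_fst fun p hp => hp.1
  have hPhi' : ContinuousOn (fun p : ℝ × ℝ => -Phi (-p.1)) square :=
    (continuousOn_Phi.comp continuousOn_fst.neg fun p hp => neg_mem_Icc_neg_one_one hp.1).neg
  have hlow := hsquare.isClosed.isClosed_le hPhi continuousOn_snd
  have hupp := hsquare.isClosed.isClosed_le continuousOn_snd hPhi'
  have hregion : exactRegion = {p ∈ square | Phi p.1 ≤ p.2} ∩ {p ∈ square | p.2 ≤ -Phi (-p.1)} := by
    rw [exactRegion_eq_regionPhi]
    ext p
    exact ⟨fun ⟨hx, hy, h, h'⟩ => ⟨⟨⟨hx, hy⟩, h⟩, ⟨hx, hy⟩, h'⟩,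
      fun ⟨⟨⟨hx, hy⟩, h⟩, _, h'⟩ => ⟨hx, hy, h, h'⟩⟩
  rw [hregion]
  exact hsquare.of_isClosed_subset (hlow.inter hupp) fun p hp => hp.1.1

theorem verticalSegment_mem_exactRegion {p : ℝ × ℝ} (hp : p ∈ exactRegion) {t : ℝ}
    (ht : t ∈ Set.Icc (0 : ℝ) 1) : (p.1, (1 - t) * p.2 + t * p.1) ∈ exactRegion := by
  obtain ⟨hx, hy⟩ := mem_exactRegion.1 hp
  obtain ⟨-, hdiag⟩ := mem_exactRegion.1 (diag_mem_exactRegion hx)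
  exact mem_exactRegion.2 ⟨hx, convex_Icc _ _ hy hdiag (sub_nonneg.2 ht.2) ht.1 (by ring)⟩

theorem shrunkDiag_mem_exactRegion {x t : ℝ} (hx : x ∈ Set.Icc (-1 : ℝ) 1)
    (ht : t ∈ Set.Icc (0 : ℝ) 1) : ((1 - t) * x, (1 - t) * x) ∈ exactRegion := by
  refine diag_mem_exactRegion ?_
  simpa using convex_Icc (-1 : ℝ) 1 hx (y := 0) (by norm_num) (sub_nonneg.2 ht.2) ht.1 (by ring)

theorem contractibleSpace_exactRegion : ContractibleSpace exactRegion := by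
  rw [contractible_iff_id_nullhomotopic]
  have hfst (p : exactRegion) : p.1.1 ∈ Set.Icc (-1 : ℝ) 1 := (mem_exactRegion.1 p.2).1
  let toDiag : C(exactRegion, exactRegion) :=
    ⟨fun p => ⟨(p.1.1, p.1.1), diag_mem_exactRegion (hfst p)⟩, by fun_prop⟩
  let origin : exactRegion := ⟨(0, 0), diag_mem_exactRegion (by norm_num)⟩
  have hvertical : (ContinuousMap.id exactRegion).Homotopic toDiag :=
    ⟨{ toFun := fun q => ⟨_, verticalSegment_mem_exactRegion q.2.2 q.1.2⟩
       continuous_toFun := by fun_prop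
       map_zero_left := fun p => by simp
       map_one_left := fun p => by simp [toDiag] }⟩
  have hshrink : toDiag.Homotopic (.const exactRegion origin) :=
    ⟨{ toFun := fun q => ⟨_, shrunkDiag_mem_exactRegion (hfst q.2) q.1.2⟩
       continuous_toFun := by fun_prop
       map_zero_left := fun p => by simp [toDiag]
       map_one_left := fun p => by simp [origin] }⟩
  exact ⟨origin, hvertical.trans hshrink⟩

theorem isSimplyConnected_exactRegion : IsSimplyConnected exactRegion :=
  have := contractibleSpace_exactRegion
  (inferInstance : SimplyConnectedSpace exactRegion)

theorem theorem5p1 :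
    exactRegion = regionPhi ∧
    copulaRegion = exactRegion ∧
    ¬ Convex ℝ exactRegion ∧
    IsCompact exactRegion ∧
    IsSimplyConnected exactRegion ∧
    (∀ p ∈ exactRegion,
      (1 + p.1) ^ 2 / 2 - 1 ≤ p.2 ∧ p.2 ≤ 1 - (1 - p.1) ^ 2 / 2) ∧
    {p ∈ exactRegion | p.2 = (1 + p.1) ^ 2 / 2 - 1} =
      {p | p = (-1, -1) ∨ ∃ n : ℕ, 1 ≤ n ∧ p = dsPoint n} ∧
    {p ∈ exactRegion | p.2 = 1 - (1 - p.1) ^ 2 / 2} =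
      {p | p = (1, 1) ∨ ∃ n : ℕ, 1 ≤ n ∧ p = -dsPoint n} :=
  ⟨exactRegion_eq_regionPhi, copulaRegion_eq_exactRegion, not_convex_exactRegion,
    isCompact_exactRegion, isSimplyConnected_exactRegion, fun _ hp => durbin_stuart hp,
    Set.ext fun _ => durbin_stuart_eq_iff, Set.ext fun _ => durbin_stuart_upper_eq_iff⟩
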